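/- Let $\mathbb T^2=(\mathbb R/2\pi\mathbb Z)^2$ with the measure $dp=dp_1\,dp_2$, and for $\gamma,\lambda,\mu\in\mathbb R$ let $H_{\gamma\lambda\mu}(0)=H_0(0)+V_{\gamma\lambda\mu}$, where $$(H_0(0)f)(p)=2\sum_{i=1}^2(1-\cos p_i)\,f(p),$$ $$(V_{\gamma\lambda\mu}f)(p)=\frac{\gamma}{4\pi^2}\int_{\mathbb T^2}f(q)\,dq+\frac{\lambda}{4\pi^2}\sum_{i=1}^2\cos p_i\int_{\mathbb T^2}\cos q_i\,f(q)\,dq+\frac{\mu}{4\pi^2}\sum_{i=1}^2\cos 2p_i\int_{\mathbb T^2}\cos 2q_i\,f(q)\,dq$$ $$\qquad+\frac{\mu}{2\pi^2}\cos p_1\cos p_2\int_{\mathbb T^2}\cos q_1\cos q_2\,f(q)\,dq+\frac{\mu}{2\pi^2}\sin p_1\sin p_2\int_{\mathbb T^2}\sin q_1\sin q_2\,f(q)\,dq .$$ Let $H^{\mathrm{ees}}_{\gamma\lambda\mu}(0)$ be the restriction of $H_{\gamma\lambda\mu}(0)$ to its reducing subspace $$L^{2,\mathrm{ees}}(\mathbb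 T^2)=\{f\in L^2(\mathbb T^2): f(-p)=f(p),\ f(p_1,p_2)=f(p_2,p_1)=f(-p_1,p_2)\}.$$ For a bounded self-adjoint operator $A$ let $n_+(A)$ and $n_-(A)$ be the numbers of eigenvalues of $A$, counted with multiplicity, that lie above, respectively below, the essential spectrum of $A$. Put $$\mu_0^{\pm}=\frac{-80+24\pi\pm\sqrt{666\pi^2-4128\pi+6400}}{3(16-5\pi)},\qquad \mu_1^{\pm}=\frac{-80+21\pi\pm\sqrt{801\pi^2-4512\pi+6400}}{12(16-5\pi)},$$ so that $\mu_0^-=-7.7170\ldots<\mu_1^-=-7.2646\ldots<\mu_0^+=-2.7880\ldots<\mu_1^+=-0.7404\ldots$. Put $$Q_0^{-}(\mu)=\tfrac{16-5\pi}{4\pi}(\mu-\mu_0^-)(\mu-\mu_0^+),\qquad Q_1^-(\mu)=\tfrac{2(16-5\pi)}{\pi}(\mu-\mu_1^-)(\mu-\mu_1^+),$$ $$\lambda^-(\mu)=-\frac{Q_1^-(\mu)}{Q_0^-(\mu)},\qquad \gamma^-(\lambda,\mu)=\frac{8Q_0^-(\mu)}{\lambda Q_0^-(\mu)+Q_1^-(\mu)}-4,$$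 $I_1^-=(\mu_0^+,\infty)$, $I_2^-=(\mu_0^-,\mu_0^+)$, $I_3^-=(-\infty,\mu_0^-)$, and $\tau_j^-=\{(\lambda,\mu):\lambda=\lambda^-(\mu),\ \mu\in I_j^-\}$ for $j=1,2,3$. Let $$D_1^-=\{\lambda>\lambda^-(\mu),\ \mu\in I_1^-\},$$ $$D_2^-=\{\lambda<\lambda^-(\mu),\ \mu\in I_1^-\}\cup\{\mu=\mu_0^+\}\cup\{\lambda>\lambda^-(\mu),\ \mu\in I_2^-\},$$ $$D_3^-=\{\lambda<\lambda^-(\mu),\ \mu\in I_2^-\}\cup\{\mu=\mu_0^-\}\cup\{\lambda>\lambda^-(\mu),\ \mu\in I_3^-\},$$ $$D_4^-=\{\lambda<\lambda^-(\mu),\ \mu\in I_3^-\}$$ (subsets of the $(\lambda,\mu)$-plane), and define subsets of the $(\gamma,\lambda,\mu)$-space by $$\mathcal C_0^-=\{\gamma>\gamma^-(\lambda,\mu),\ (\lambda,\mu)\in D_1^-\},$$ $$\mathcal C_\zeta^-=\{\gamma<\gamma^-(\lambda,\mu),\ (\lambda,\mu)\in D_\zeta^-\}\cup\{(\lambda,\mu)\in\tau_\zeta^-\}\cup\{\gamma>\gamma^-(\lambda,\mu),\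 (\lambda,\mu)\in D_{\zeta+1}^-\}\qquad(\zeta=1,2,3),$$ $$\mathcal C_4^-=\{\gamma<\gamma^-(\lambda,\mu),\ (\lambda,\mu)\in D_4^-\}.$$ The sets $\mathcal C_\zeta^+$ are the reflections $\mathcal C_\zeta^+=-\mathcal C_\zeta^-$ in the origin; equivalently, they are given by the same construction from $$Q_0^{+}(\mu)=\tfrac{16-5\pi}{4\pi}(\mu+\mu_0^-)(\mu+\mu_0^+),\quad Q_1^+(\mu)=\tfrac{2(16-5\pi)}{\pi}(\mu+\mu_1^-)(\mu+\mu_1^+),$$ $$\lambda^+=\frac{Q_1^+}{Q_0^+},\quad \gamma^+=\frac{8Q_0^+}{\lambda Q_0^+-Q_1^+}+4,\quad I_j^+=-I_j^-,$$ with all inequalities between $\lambda$ and $\lambda^+(\mu)$ and between $\gamma$ and $\gamma^+(\lambda,\mu)$ reversed, and with the lines $\mu=\mu_0^{+}$, $\mu=\mu_0^-$ replaced by $\mu=-\mu_0^{+}$, $\mu=-\mu_0^-$. **Theorem.** Let $\zeta\in\{0,1,2,3,4\}$. The number $n_+\bigl(H^{\mathrm{ees}}_{\gamma\lambda\mu}(0)\bigr)$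 is finite and has the same value for all $(\gamma,\lambda,\mu)\in\mathcal C_\zeta^+$. Likewise, the number $n_-\bigl(H^{\mathrm{ees}}_{\gamma\lambda\mu}(0)\bigr)$ is finite and has the same value for all $(\gamma,\lambda,\mu)\in\mathcal C_\zeta^-$. -/

import Mathlib

open MeasureTheory

noncomputable section

namespace TwoBoson

/-! ### The torus and its `L²`-space -/

instance fact_two_pi_pos : Fact ((0 : ℝ) < 2 * Real.pi) := ⟨Real.two_pi_pos⟩

/-- The circle `ℝ / 2πℤ`, with its Haar measure of total mass `2π`. -/
abbrev Circ : Type := AddCircle (2 * Real.pi)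

/-- The two-dimensional torus `(ℝ / 2πℤ)²`, with the measure `dp = dp₁ dp₂` of total mass `4π²`. -/
abbrev Torus2 : Type := Circ × Circ

/-- The Hilbert space of (classes of) complex square-integrable functions on the torus. -/
abbrev L2 : Type := Lp ℂ 2 (volume : Measure Torus2)

/-- The cosine as a function on the circle. -/
def cosC : C(Circ, ℝ) where
  toFun := Real.cos_periodic.lift
  continuous_toFun := continuous_coinduced_dom.mpr Real.continuous_cos

/-- The sine as a function on the circle. -/
def sinC : C(Circ, ℝ) where
  toFun := Real.sin_periodic.lift
  continuous_toFun := continuous_coinduced_dom.mpr Real.continuous_sin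

theorem cosC_coe (x : ℝ) : cosC (x : Circ) = Real.cos x := rfl

theorem sinC_coe (x : ℝ) : sinC (x : Circ) = Real.sin x := rfl

theorem cosC_neg (x : Circ) : cosC (-x) = cosC x := by
  induction x using QuotientAddGroup.induction_on with
  | H z => rw [← QuotientAddGroup.mk_neg]; exact Real.cos_neg z

theorem sinC_neg (x : Circ) : sinC (-x) = -sinC x := by
  induction x using QuotientAddGroup.induction_on with
  | H z => rw [← QuotientAddGroup.mk_neg]; exact Real.sin_neg z

/-! ### The two-boson operator at zero quasi-momentum -/

/-- The constant function `1`. -/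
def fOne : C(Torus2, ℂ) := ⟨fun _ => 1, by fun_prop⟩

/-- `p ↦ cos p₁`. -/
def fCos1 : C(Torus2, ℂ) := ⟨fun p => (cosC p.1 : ℂ), by fun_prop⟩

/-- `p ↦ cos p₂`. -/
def fCos2 : C(Torus2, ℂ) := ⟨fun p => (cosC p.2 : ℂ), by fun_prop⟩

/-- `p ↦ cos 2p₁`. -/
def fCosTwo1 : C(Torus2, ℂ) := ⟨fun p => (cosC ((2 : ℕ) • p.1) : ℂ), by fun_prop⟩

/-- `p ↦ cos 2p₂`. -/
def fCosTwo2 : C(Torus2, ℂ) := ⟨fun p => (cosC ((2 : ℕ) • p.2) : ℂ), by fun_prop⟩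

/-- `p ↦ cos p₁ cos p₂`. -/
def fCosCos : C(Torus2, ℂ) := ⟨fun p => (cosC p.1 : ℂ) * (cosC p.2 : ℂ), by fun_prop⟩

/-- `p ↦ sin p₁ sin p₂`. -/
def fSinSin : C(Torus2, ℂ) := ⟨fun p => (sinC p.1 : ℂ) * (sinC p.2 : ℂ), by fun_prop⟩

/-- The dispersion function `ℰ₀(p) = 2 ∑ᵢ (1 - cos pᵢ)`. -/
def fDisp : C(Torus2, ℂ) :=
  ⟨fun p => 2 * ((1 - (cosC p.1 : ℂ)) + (1 - (cosC p.2 : ℂ))), by fun_prop⟩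

/-- The class in `L²` of a continuous function. -/
def toL2 (a : C(Torus2, ℂ)) : L2 := ContinuousMap.toLp 2 volume ℂ a

theorem memLp_mul (a : C(Torus2, ℂ)) (f : L2) :
    MemLp (fun p => a p * f p) 2 (volume : Measure Torus2) :=
  (Lp.memLp f).of_le_mul (c := ‖a‖) (a.continuous.aestronglyMeasurable.mul (Lp.memLp f).1)
    (Filter.Eventually.of_forall fun p => by
      rw [norm_mul]
      exact mul_le_mul_of_nonneg_right (a.norm_coe_le_norm p) (norm_nonneg _))

/-- The operator of multiplication by a continuous function `a`: `f ↦ a f`. -/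
def mulOp (a : C(Torus2, ℂ)) : L2 →L[ℂ] L2 :=
  LinearMap.mkContinuous
    { toFun := fun f => (memLp_mul a f).toLp (fun p => a p * f p)
      map_add' := fun f g => by
        rw [← MemLp.toLp_add, MemLp.toLp_eq_toLp_iff]
        filter_upwards [Lp.coeFn_add f g] with p hp
        rw [hp, Pi.add_apply, Pi.add_apply, mul_add]
      map_smul' := fun c f => by
        rw [RingHom.id_apply, ← MemLp.toLp_const_smul, MemLp.toLp_eq_toLp_iff]
        filter_upwards [Lp.coeFn_smul c f] with p hp
        simp [hp, mul_left_comm] }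
    ‖a‖ (fun f => by
      refine Lp.norm_le_mul_norm_of_ae_le_mul ?_
      filter_upwards [(memLp_mul a f).coeFn_toLp] with p hp
      change ‖((memLp_mul a f).toLp (fun p => a p * f p)) p‖ ≤ _
      rw [hp, norm_mul]
      exact mul_le_mul_of_nonneg_right (a.norm_coe_le_norm p) (norm_nonneg _))

/-- The rank-one operator `(proj a f)(p) = a(p) ∫ conj (a(q)) f(q) dq`; it is used for the
real-valued functions `a` above. -/
def proj (a : C(Torus2, ℂ)) : L2 →L[ℂ] L2 :=
  InnerProductSpace.rankOne ℂ (toL2 a) (toL2 a)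

/-- The interaction `V_{γλμ}` in the quasi-momentum representation. -/
def interaction (γ lam μ : ℝ) : L2 →L[ℂ] L2 :=
  ((γ / (4 * Real.pi ^ 2) : ℝ) : ℂ) • proj fOne
    + ((lam / (4 * Real.pi ^ 2) : ℝ) : ℂ) • (proj fCos1 + proj fCos2)
    + ((μ / (4 * Real.pi ^ 2) : ℝ) : ℂ) • (proj fCosTwo1 + proj fCosTwo2)
    + ((μ / (2 * Real.pi ^ 2) : ℝ) : ℂ) • proj fCosCos
    + ((μ / (2 * Real.pi ^ 2) : ℝ) : ℂ) • proj fSinSin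

/-- The two-boson Schrödinger operator `H_{γλμ}(0) = H₀(0) + V_{γλμ}`. -/
def hamiltonian (γ lam μ : ℝ) : L2 →L[ℂ] L2 :=
  mulOp fDisp + interaction γ lam μ

/-! ### The reducing subspace `L^{2,ees}` -/

/-- The functions `f` with `f (σ p) = f p` for almost every `p`. -/
def invariantL2 (σ : Torus2 → Torus2) (hσ : MeasurePreserving σ volume volume) :
    Submodule ℂ L2 where
  carrier := {f | ∀ᵐ p ∂(volume : Measure Torus2), f (σ p) = f p}
  zero_mem' := by
    have h := Lp.coeFn_zero ℂ 2 (volume : Measure Torus2)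
    filter_upwards [h, hσ.quasiMeasurePreserving.ae h] with p hp hq
    rw [hp, hq]; rfl
  add_mem' := by
    intro f g hf hg
    have h := Lp.coeFn_add f g
    filter_upwards [hf, hg, h, hσ.quasiMeasurePreserving.ae h] with p h1 h2 h3 h4
    rw [h3, h4, Pi.add_apply, Pi.add_apply, h1, h2]
  smul_mem' := by
    intro c f hf
    have h := Lp.coeFn_smul c f
    filter_upwards [hf, h, hσ.quasiMeasurePreserving.ae h] with p h1 h3 h4
    rw [h3, h4, Pi.smul_apply, Pi.smul_apply, h1]

theorem mp_neg : MeasurePreserving (fun p : Torus2 => -p) volume volume :=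
  (Measure.measurePreserving_neg (volume : Measure Circ)).prod
    (Measure.measurePreserving_neg (volume : Measure Circ))

theorem mp_swap : MeasurePreserving (fun p : Torus2 => (p.2, p.1)) volume volume :=
  Measure.measurePreserving_swap

theorem mp_refl : MeasurePreserving (fun p : Torus2 => (-p.1, p.2)) volume volume :=
  (Measure.measurePreserving_neg (volume : Measure Circ)).prod (MeasurePreserving.id volume)

/-- The space `L^{2,ees}` of all `f ∈ L²` with
`f(-p) = f(p)` and `f(p₁, p₂) = f(p₂, p₁) = f(-p₁, p₂)`. -/
def L2ees : Submodule ℂ L2 :=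
  invariantL2 (fun p => -p) mp_neg ⊓ invariantL2 (fun p => (p.2, p.1)) mp_swap
    ⊓ invariantL2 (fun p => (-p.1, p.2)) mp_refl

theorem mulOp_mem (σ : Torus2 → Torus2) (hσ : MeasurePreserving σ volume volume)
    (a : C(Torus2, ℂ)) (ha : ∀ p, a (σ p) = a p) (f : L2) (hf : f ∈ invariantL2 σ hσ) :
    mulOp a f ∈ invariantL2 σ hσ := by
  have h : ∀ᵐ p ∂(volume : Measure Torus2), mulOp a f p = a p * f p :=
    (memLp_mul a f).coeFn_toLp
  filter_upwards [hf, h, hσ.quasiMeasurePreserving.ae h] with p h1 h2 h3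
  rw [h2, h3, h1, ha]

theorem coeFn_toL2 (a : C(Torus2, ℂ)) :
    ∀ᵐ p ∂(volume : Measure Torus2), toL2 a p = a p :=
  ContinuousMap.coeFn_toLp volume a

theorem toL2_mem (σ : Torus2 → Torus2) (hσ : MeasurePreserving σ volume volume)
    (a : C(Torus2, ℂ)) (ha : ∀ p, a (σ p) = a p) : toL2 a ∈ invariantL2 σ hσ := by
  have h := coeFn_toL2 a
  filter_upwards [h, hσ.quasiMeasurePreserving.ae h] with p h2 h3
  rw [h2, h3, ha]

theorem inner_comp (σ : Torus2 → Torus2) (hσ : MeasurePreserving σ volume volume)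
    (hi : ∀ p, σ (σ p) = p) (a b : C(Torus2, ℂ)) (hab : ∀ p, a (σ p) = b p) (f : L2)
    (hf : f ∈ invariantL2 σ hσ) : inner ℂ (toL2 a) f = inner ℂ (toL2 b) f := by
  have hemb : MeasurableEmbedding σ :=
    (MeasurableEquiv.mk ⟨σ, σ, hi, hi⟩ hσ.measurable hσ.measurable).measurableEmbedding
  rw [L2.inner_def, L2.inner_def, ← hσ.integral_comp hemb]
  have h := coeFn_toL2 a
  refine integral_congr_ae ?_
  filter_upwards [hf, coeFn_toL2 b, hσ.quasiMeasurePreserving.ae h] with p h1 h2 h3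
  rw [h1, h2, h3, hab]

theorem proj_apply (a : C(Torus2, ℂ)) (f : L2) :
    proj a f = inner ℂ (toL2 a) f • toL2 a := rfl

theorem fSinSin_inner (f : L2) (hf : f ∈ L2ees) : inner ℂ (toL2 fSinSin) f = 0 := by
  have h := inner_comp _ mp_refl (fun p => by simp) fSinSin (-fSinSin)
    (fun p => by simp [fSinSin, sinC_neg]) f hf.2
  have h2 : toL2 (-fSinSin) = -toL2 fSinSin := map_neg (ContinuousMap.toLp 2 volume ℂ) _
  rw [h2, inner_neg_left] at h
  exact self_eq_neg.mp h

theorem fCos_inner (f : L2) (hf : f ∈ L2ees) :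
    inner ℂ (toL2 fCos2) f = inner ℂ (toL2 fCos1) f :=
  inner_comp _ mp_swap (fun _ => rfl) fCos2 fCos1 (fun _ => rfl) f hf.1.2

theorem fCosTwo_inner (f : L2) (hf : f ∈ L2ees) :
    inner ℂ (toL2 fCosTwo2) f = inner ℂ (toL2 fCosTwo1) f :=
  inner_comp _ mp_swap (fun _ => rfl) fCosTwo2 fCosTwo1 (fun _ => rfl) f hf.1.2

theorem toL2_mem_ees (a : C(Torus2, ℂ)) (h1 : ∀ p, a (-p) = a p)
    (h2 : ∀ p : Torus2, a (p.2, p.1) = a p) (h3 : ∀ p : Torus2, a (-p.1, p.2) = a p) :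
    toL2 a ∈ L2ees :=
  ⟨⟨toL2_mem _ mp_neg a h1, toL2_mem _ mp_swap a h2⟩, toL2_mem _ mp_refl a h3⟩

theorem toL2_add (a b : C(Torus2, ℂ)) : toL2 a + toL2 b = toL2 (a + b) :=
  (map_add (ContinuousMap.toLp 2 volume ℂ) a b).symm

/-- The subspace `L^{2,ees}` is invariant under `H_{γλμ}(0)`. -/
theorem hamiltonian_mem (γ lam μ : ℝ) (f : L2) (hf : f ∈ L2ees) :
    hamiltonian γ lam μ f ∈ L2ees := by
  have hD : mulOp fDisp f ∈ L2ees :=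
    ⟨⟨mulOp_mem _ mp_neg _ (fun p => by simp [fDisp, cosC_neg]) f hf.1.1,
      mulOp_mem _ mp_swap _ (fun p => by simp [fDisp, add_comm]) f hf.1.2⟩,
      mulOp_mem _ mp_refl _ (fun p => by simp [fDisp, cosC_neg]) f hf.2⟩
  have h1 : proj fOne f ∈ L2ees :=
    L2ees.smul_mem _ (toL2_mem_ees _ (fun _ => rfl) (fun _ => rfl) (fun _ => rfl))
  have h2 : (proj fCos1 + proj fCos2) f ∈ L2ees := by
    rw [_root_.add_apply, proj_apply, proj_apply, fCos_inner f hf, ← smul_add,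
      toL2_add]
    exact L2ees.smul_mem _ (toL2_mem_ees _ (fun p => by simp [fCos1, fCos2, cosC_neg])
      (fun p => by simp [fCos1, fCos2, add_comm]) (fun p => by simp [fCos1, fCos2, cosC_neg]))
  have h3 : (proj fCosTwo1 + proj fCosTwo2) f ∈ L2ees := by
    rw [_root_.add_apply, proj_apply, proj_apply, fCosTwo_inner f hf, ← smul_add,
      toL2_add]
    exact L2ees.smul_mem _ (toL2_mem_ees _
      (fun p => by simp [fCosTwo1, fCosTwo2, cosC_neg])
      (fun p => by simp [fCosTwo1, fCosTwo2, add_comm])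
      (fun p => by simp [fCosTwo1, fCosTwo2, cosC_neg]))
  have h4 : proj fCosCos f ∈ L2ees :=
    L2ees.smul_mem _ (toL2_mem_ees _ (fun p => by simp [fCosCos, cosC_neg])
      (fun p => by simp [fCosCos, mul_comm]) (fun p => by simp [fCosCos, cosC_neg]))
  have h5 : proj fSinSin f ∈ L2ees := by
    rw [proj_apply, fSinSin_inner f hf, zero_smul]
    exact L2ees.zero_mem
  exact L2ees.add_mem hD (L2ees.add_mem (L2ees.add_mem (L2ees.add_mem (L2ees.add_mem
    (L2ees.smul_mem _ h1) (L2ees.smul_mem _ h2)) (L2ees.smul_mem _ h3)) (L2ees.smul_mem _ h4))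
    (L2ees.smul_mem _ h5))

/-- The operator `H^{ees}_{γλμ}(0)`: the restriction of `H_{γλμ}(0)` to `L^{2,ees}`. -/
def hamiltonianEES (γ lam μ : ℝ) : L2ees →L[ℂ] L2ees :=
  (hamiltonian γ lam μ).restrict (hamiltonian_mem γ lam μ)

/-! ### Essential spectrum and numbers of eigenvalues -/

section Spectrum

variable {E : Type} [NormedAddCommGroup E] [NormedSpace ℂ E]

/-- The essential spectrum: all `w` such that `A - w` is not a Fredholm operator. -/
def essSpectrum (A : E →L[ℂ] E) : Set ℂ :=
  {w | ¬ (A - w • ContinuousLinearMap.id ℂ E).IsFredholm}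

/-- The number, counting multiplicities, of the real eigenvalues of `A` in the set `S`: the sum
over `z ∈ S` of the dimensions of the spaces `ker (A - z)`. -/
def eigenvalueCount (A : E →L[ℂ] E) (S : Set ℝ) : ℕ∞ :=
  Cardinal.toENat (Cardinal.sum fun z : S =>
    Module.rank ℂ (Module.End.eigenspace (A : Module.End ℂ E) ((z : ℝ) : ℂ)))

/-- The number `n₊(A)` of eigenvalues (with multiplicities) above the essential spectrum of a
bounded self-adjoint operator `A`. -/
def numAbove (A : E →L[ℂ] E) : ℕ∞ :=
  eigenvalueCount A {z | ∀ w ∈ essSpectrum A, w.re < z}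

/-- The number `n₋(A)` of eigenvalues (with multiplicities) below the essential spectrum of a
bounded self-adjoint operator `A`. -/
def numBelow (A : E →L[ℂ] E) : ℕ∞ :=
  eigenvalueCount A {z | ∀ w ∈ essSpectrum A, z < w.re}

end Spectrum

/-! ### The components of the parameter space

The sign `±` is a real parameter `s`, with `s = 1` for `+` and `s = -1` for `-`. -/

/-- `μ₀⁻ = -7.7170…` -/
def mu0m : ℝ :=
  (-80 + 24 * Real.pi - √(666 * Real.pi ^ 2 - 4128 * Real.pi + 6400)) / (3 * (16 - 5 * Real.pi))

/-- `μ₀⁺ = -2.7880…` -/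
def mu0p : ℝ :=
  (-80 + 24 * Real.pi + √(666 * Real.pi ^ 2 - 4128 * Real.pi + 6400)) / (3 * (16 - 5 * Real.pi))

/-- `μ₁⁻ = -7.2646…` -/
def mu1m : ℝ :=
  (-80 + 21 * Real.pi - √(801 * Real.pi ^ 2 - 4512 * Real.pi + 6400)) / (12 * (16 - 5 * Real.pi))

/-- `μ₁⁺ = -0.7404…` -/
def mu1p : ℝ :=
  (-80 + 21 * Real.pi + √(801 * Real.pi ^ 2 - 4512 * Real.pi + 6400)) / (12 * (16 - 5 * Real.pi))

/-- The polynomial `Q₀^±(μ)`. -/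
def Q0 (s μ : ℝ) : ℝ :=
  (16 - 5 * Real.pi) / (4 * Real.pi) * (μ + s * mu0m) * (μ + s * mu0p)

/-- The polynomial `Q₁^±(μ)`. -/
def Q1 (s μ : ℝ) : ℝ :=
  2 * (16 - 5 * Real.pi) / Real.pi * (μ + s * mu1m) * (μ + s * mu1p)

/-- The intervals: `I₁⁻ = (μ₀⁺, ∞)` and `I₁⁺ = -I₁⁻ = (-∞, -μ₀⁺)`. -/
def I1 (s : ℝ) : Set ℝ := {μ | s * μ < -mu0p}

/-- `I₂⁻ = (μ₀⁻, μ₀⁺)` and `I₂⁺ = -I₂⁻ = (-μ₀⁺, -μ₀⁻)`. -/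
def I2 (s : ℝ) : Set ℝ := {μ | -mu0p < s * μ ∧ s * μ < -mu0m}

/-- `I₃⁻ = (-∞, μ₀⁻)` and `I₃⁺ = -I₃⁻ = (-μ₀⁻, ∞)`. -/
def I3 (s : ℝ) : Set ℝ := {μ | -mu0m < s * μ}

/-- The function `λ^±(μ) = ± Q₁^±(μ) / Q₀^±(μ)`, used only where `Q₀^±(μ) ≠ 0`. -/
def lamCurve (s μ : ℝ) : ℝ := s * (Q1 s μ / Q0 s μ)

/-- The function `γ^±(λ, μ)`, used only where its denominator is nonzero. -/
def gamSurf (s lam μ : ℝ) : ℝ := 8 * Q0 s μ / (lam * Q0 s μ - s * Q1 s μ) + 4 * s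

/-- The curves `τ_j^±` over an interval `I = I_j^±`. -/
def tau (s : ℝ) (I : Set ℝ) : Set (ℝ × ℝ) := {x | x.2 ∈ I ∧ x.1 = lamCurve s x.2}

/-- The points `(λ, μ)` over the interval `I` with `λ > λ⁻(μ)`, respectively `λ < λ⁺(μ)`. -/
def before (s : ℝ) (I : Set ℝ) : Set (ℝ × ℝ) := {x | x.2 ∈ I ∧ s * x.1 < s * lamCurve s x.2}

/-- The points `(λ, μ)` over the interval `I` with `λ < λ⁻(μ)`, respectively `λ > λ⁺(μ)`. -/
def beyond (s : ℝ) (I : Set ℝ) : Set (ℝ × ℝ) := {x | x.2 ∈ I ∧ s * lamCurve s x.2 < s * x.1}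

/-- The region `D₁^±` of the `(λ, μ)`-plane. -/
def D1 (s : ℝ) : Set (ℝ × ℝ) := before s (I1 s)

/-- The region `D₂^±`; it contains the line `μ = ∓ μ₀⁺`. -/
def D2 (s : ℝ) : Set (ℝ × ℝ) := beyond s (I1 s) ∪ {x | x.2 = -s * mu0p} ∪ before s (I2 s)

/-- The region `D₃^±`; it contains the line `μ = ∓ μ₀⁻`. -/
def D3 (s : ℝ) : Set (ℝ × ℝ) := beyond s (I2 s) ∪ {x | x.2 = -s * mu0m} ∪ before s (I3 s)

/-- The region `D₄^±`. -/
def D4 (s : ℝ) : Set (ℝ × ℝ) := beyond s (I3 s)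

/-- The points `(γ, λ, μ)` over `D` with `γ > γ⁻(λ, μ)`, respectively `γ < γ⁺(λ, μ)`. -/
def before3 (s : ℝ) (D : Set (ℝ × ℝ)) : Set (ℝ × ℝ × ℝ) :=
  {x | x.2 ∈ D ∧ s * x.1 < s * gamSurf s x.2.1 x.2.2}

/-- The points `(γ, λ, μ)` over `D` with `γ < γ⁻(λ, μ)`, respectively `γ > γ⁺(λ, μ)`. -/
def beyond3 (s : ℝ) (D : Set (ℝ × ℝ)) : Set (ℝ × ℝ × ℝ) :=
  {x | x.2 ∈ D ∧ s * gamSurf s x.2.1 x.2.2 < s * x.1}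

/-- The cylinder over a subset of the `(λ, μ)`-plane. -/
def cyl (t : Set (ℝ × ℝ)) : Set (ℝ × ℝ × ℝ) := {x | x.2 ∈ t}

/-- The components `𝒞_ζ^±`, `ζ = 0, …, 4`, of the `(γ, λ, μ)`-space. -/
def component (s : ℝ) : Fin 5 → Set (ℝ × ℝ × ℝ)
  | 0 => before3 s (D1 s)
  | 1 => beyond3 s (D1 s) ∪ cyl (tau s (I1 s)) ∪ before3 s (D2 s)
  | 2 => beyond3 s (D2 s) ∪ cyl (tau s (I2 s)) ∪ before3 s (D3 s)
  | 3 => beyond3 s (D3 s) ∪ cyl (tau s (I3 s)) ∪ before3 s (D4 s)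
  | 4 => beyond3 s (D4 s)

end TwoBoson

end

/-!
In both cases the common value of the number of eigenvalues is `ζ`, and everything reduces to the
signature of an explicit real quadratic form in four variables.

Write `f₀, f₁, f₂, f₃` for the lattice values `⟨1, f⟩`, `⟨cos p₁, f⟩`, `⟨cos 2p₁, f⟩`,
`⟨cos p₁ cos p₂, f⟩` of a function `f ∈ L^{2,ees}`. On `L^{2,ees}` the interaction is diagonal in
these values: `4π² ⟨f, V f⟩ = γ|f₀|² + 2λ|f₁|² + 2μ(|f₂|² + |f₃|²)` (`inner_interaction`). The free
part is the Dirichlet form of the square lattice, and the infimum of `4π² ⟨f, H₀ f⟩` over all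
functions with given four values is
`4|f₀ - f₁|² + 4|f₁ - f₂|² + 8|f₁ - f₃|² + κ|f₂ - f₃|²`
(`traceForm_le_energy`, with the deviation in `energy_eq`). The minimizers are combinations of `1`,
`cos p₁ + cos p₂` and `(1 - cos p₁)(1 - cos p₂) / ℰ₀(p)`, corrected by a constant on the lattice;
the constant `κ = kap` comes from the integral `∫ (1 - cos p₁)²(1 - cos p₂)² / ℰ₀(p) dp`
(`integral_product_mul_potential`). The lattice is recurrent, that is, `∫ dp / ℰ₀(p) = ∞`
(`exists_lt_integral_resolvent`), so that constants on the lattice have square-integrable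
approximations of arbitrarily small energy (`exists_approx_const`). This makes the infimum approachable on a finite-dimensional space of
trial functions, although there is no minimizer in `L²` when the correcting constant is nonzero.

The interaction has finite rank and the free part is positive, injective and not bounded below, so
the essential spectrum lies in `[0, ∞)` and contains `0` (`essSpectrum_subset`,
`zero_mem_essSpectrum`). A form that is negative on a space of dimension `n` and nonnegative on a
subspace of codimension `n` then has exactly `n` negative eigenvalues (`eigenvalueCount_neg`). Hence
`n₋` is the number of negative squares of the reduced form (`numBelow_of_hasNegIndex`).

The block of the variables `v₂, v₃` has eigenvalues proportional to `μ - μ₀⁻` and `μ - μ₀⁺`; the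
Schur complement of this block is `2 (λ - λ⁻(μ))` in the variable `v₁`, and the next one is
`γ - γ⁻(λ, μ)` in `v₀`. If an eigenvalue of the block or the Schur complement vanishes, the
variable concerned spans a hyperbolic plane together with `v₁` or `v₀` respectively, and this plane
contributes exactly one negative square. Counting signs over the components gives `ζ` (`hasNegIndex_of_mem_component`).

Translation by `(π, π)` conjugates `H_{γλμ}(0)` to `8 - H_{-γ,-λ,-μ}(0)` (`shift_hamiltonian`) and
so reduces `n₊` on `𝒞_ζ^+` to `n₋` on `𝒞_ζ^-`.
-/

noncomputable section

namespace TwoBoson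

/-! ### Finite-rank perturbations of positive operators -/

section Abstract

open scoped LinearMap.FiniteRangeSetoid

theorem isFredholm_add_finiteRange {E : Type*} [NormedAddCommGroup E] [NormedSpace ℂ E]
    {A F : E →L[ℂ] E} (hA : A.IsFredholm) (hF : F.toLinearMap.HasFiniteRange) :
    (A + F).IsFredholm := by
  obtain ⟨v, hv⟩ := hA.exists_isQuasiInverse
  refine .of_isQuasiInverse (v := v) (hv.congr (Setoid.refl _) ?_)
  rw [LinearMap.FiniteRangeSetoid.equiv_iff_hasFiniteRange]
  simpa using hF

theorem isFredholm_of_isUnit {E : Type*} [NormedAddCommGroup E] [NormedSpace ℂ E]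
    {A : E →L[ℂ] E} (hA : IsUnit A) : A.IsFredholm := by
  obtain ⟨u, rfl⟩ := hA
  exact .of_isQuasiInverse (ContinuousLinearEquiv.unitsEquiv ℂ E u).toLinearEquiv.isQuasiInverse

/-- An injective operator of the form `invertible + finite rank` is invertible. -/
theorem isUnit_add_finiteRange {E : Type*} [NormedAddCommGroup E] [NormedSpace ℂ E]
    [CompleteSpace E] {A F : E →L[ℂ] E} (hA : IsUnit A) (hF : F.toLinearMap.HasFiniteRange)
    (hinj : Function.Injective (A + F)) : IsUnit (A + F) := by
  rw [ContinuousLinearMap.isUnit_iff_bijective]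
  obtain ⟨u, rfl⟩ := hA
  let e : E ≃L[ℂ] E := ContinuousLinearEquiv.unitsEquiv ℂ E u
  have he : ∀ x, (u : E →L[ℂ] E) x = e x := fun _ => rfl
  refine ⟨hinj, fun y => ?_⟩
  -- `1 + e⁻¹ F` maps the finite-dimensional range of `e⁻¹ F` injectively to itself.
  let G : E →ₗ[ℂ] E := e.symm.toLinearEquiv.toLinearMap ∘ₗ F.toLinearMap
  have hG : ∀ x, G x = e.symm (F x) := fun _ => rfl
  have : FiniteDimensional ℂ G.range := Module.Finite.of_fg (hF.comp_left _).fg_range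
  have hmaps : ∀ x ∈ G.range, (LinearMap.id + G : E →ₗ[ℂ] E) x ∈ G.range := fun x hx =>
    G.range.add_mem hx (LinearMap.mem_range_self G x)
  have hRinj : Function.Injective ((LinearMap.id + G : E →ₗ[ℂ] E).restrict hmaps) := by
    rintro ⟨a, ha⟩ ⟨b, hb⟩ hab
    have hab' : a + G a = b + G b := congrArg Subtype.val hab
    refine Subtype.ext (hinj ?_)
    have := congrArg e hab'
    simpa [hG, he] using this
  obtain ⟨⟨r, hr⟩, hr'⟩ := LinearMap.injective_iff_surjective.mp hRinj
    ⟨G (e.symm y), LinearMap.mem_range_self G _⟩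
  have hr'' : r + G r = G (e.symm y) := congrArg Subtype.val hr'
  refine ⟨e.symm y - r, ?_⟩
  have h1 : e r + F r = F (e.symm y) := by
    have := congrArg e hr''
    simpa [hG] using this
  rw [_root_.add_apply, he, map_sub, map_sub, e.apply_symm_apply, ← h1]
  abel

/-- The span of the eigenvectors with negative eigenvalues. -/
def negSpace {E : Type} [NormedAddCommGroup E] [NormedSpace ℂ E]
    (A : E →L[ℂ] E) : Submodule ℂ E :=
  ⨆ z : Set.Iio (0 : ℝ), Module.End.eigenspace (A : Module.End ℂ E) ((z : ℝ) : ℂ)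

theorem eigenvalueCount_eq_rank_negSpace {E : Type} [NormedAddCommGroup E] [NormedSpace ℂ E]
    (A : E →L[ℂ] E) :
    eigenvalueCount A (Set.Iio 0) = Cardinal.toENat (Module.rank ℂ (negSpace A)) := by
  classical
  have hind : iSupIndep fun z : Set.Iio (0 : ℝ) =>
      Module.End.eigenspace (A : Module.End ℂ E) ((z : ℝ) : ℂ) :=
    (Module.End.eigenspaces_iSupIndep (A : Module.End ℂ E)).comp
      (f := fun z : Set.Iio (0 : ℝ) => ((z : ℝ) : ℂ))
      (fun a b h => Subtype.ext (Complex.ofReal_injective h))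
  rw [eigenvalueCount, ← rank_directSum]
  congr 1
  have hr : negSpace A = LinearMap.range (DFinsupp.lsum ℕ fun z : Set.Iio (0 : ℝ) =>
      (Module.End.eigenspace (A : Module.End ℂ E) ((z : ℝ) : ℂ)).subtype) :=
    Submodule.iSup_eq_range_dfinsupp_lsum _
  rw [hr]
  exact (LinearEquiv.ofInjective _ hind.dfinsupp_lsum_injective).rank_eq

variable {K : Type} [NormedAddCommGroup K] [InnerProductSpace ℂ K] [CompleteSpace K]

theorem isUnit_sub_of_re_neg {T : K →L[ℂ] K} (hT : T.IsPositive) {w : ℂ} (hw : w.re < 0) :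
    IsUnit (T - w • ContinuousLinearMap.id ℂ K) := by
  refine ContinuousLinearMap.isUnit_of_forall_le_norm_inner_map _ (c := (-w.re).toNNReal)
    (by simpa using hw) fun x => ?_
  refine le_trans ?_ (Complex.re_le_norm _)
  have h1 := hT.re_inner_nonneg_left x
  have h2 : inner ℂ x x = ((‖x‖ ^ 2 : ℝ) : ℂ) := by simp [inner_self_eq_norm_sq_to_K]
  simp only [_root_.sub_apply, _root_.smul_apply,
    ContinuousLinearMap.id_apply, inner_sub_left, inner_smul_left, h2, Complex.sub_re,
    Complex.re_mul_ofReal, Complex.conj_re]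
  have h1' : 0 ≤ (inner ℂ (T x) x).re := h1
  rw [Real.coe_toNNReal _ (by linarith)]
  linarith

theorem essSpectrum_subset {T F : K →L[ℂ] K} (hT : T.IsPositive)
    (hF : F.toLinearMap.HasFiniteRange) {w : ℂ} (hw : w ∈ essSpectrum (T + F)) : 0 ≤ w.re := by
  by_contra h
  apply hw
  rw [add_sub_right_comm]
  exact isFredholm_add_finiteRange (isFredholm_of_isUnit (isUnit_sub_of_re_neg hT (not_le.mp h))) hF

/-- An injective self-adjoint operator which is not bounded below stays non-Fredholm under
finite-rank perturbations. -/
theorem zero_mem_essSpectrum {T F : K →L[ℂ] K} (hT : IsSelfAdjoint T)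
    (hF : F.toLinearMap.HasFiniteRange) (hinj : Function.Injective T)
    (hT0 : ∀ C : ℝ, ∃ f : K, C * ‖T f‖ < ‖f‖) : (0 : ℂ) ∈ essSpectrum (T + F) := by
  intro h
  rw [zero_smul, sub_zero] at h
  have h1 : T.IsFredholm := by
    have := isFredholm_add_finiteRange h (F := -F) (by simpa using hF.neg)
    simpa using this
  have hd : T.range = ⊤ := by
    have : CompleteSpace T.range := h1.isClosed_range.completeSpace_coe
    rw [← Submodule.orthogonal_eq_bot_iff, ContinuousLinearMap.orthogonal_range,
      hT.adjoint_eq]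
    exact LinearMap.ker_eq_bot.mpr hinj
  let e := ContinuousLinearEquiv.ofBijective T (LinearMap.ker_eq_bot.mpr hinj) hd
  obtain ⟨f, hf⟩ := hT0 ‖(e.symm : K →L[ℂ] K)‖
  have h2 := (e.symm : K →L[ℂ] K).le_opNorm (T f)
  have h3 : e.symm (T f) = f := e.symm_apply_apply f
  rw [ContinuousLinearEquiv.coe_coe, h3] at h2
  linarith

/-- If a finite-rank self-adjoint perturbation of a positive operator has no negative
eigenvalue, it is positive. -/
theorem isPositive_of_no_neg_eigenvalue {T F : K →L[ℂ] K} (hT : T.IsPositive)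
    (hF : F.toLinearMap.HasFiniteRange) (hS : IsSelfAdjoint (T + F))
    (hev : ∀ z : ℝ, z < 0 → ∀ x : K, (T + F) x = (z : ℂ) • x → x = 0) :
    (T + F).IsPositive := by
  rw [← ContinuousLinearMap.nonneg_iff_isPositive,
    StarOrderedRing.nonneg_iff_spectrum_nonneg (R := ℝ) (T + F)]
  intro z hz
  by_contra hneg
  rw [not_le] at hneg
  apply hz
  have h1 := isUnit_sub_of_re_neg hT (w := (z : ℂ)) (by simpa using hneg)
  have h2 : IsUnit (T - (z : ℂ) • ContinuousLinearMap.id ℂ K + F) := by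
    refine isUnit_add_finiteRange h1 hF ?_
    rw [injective_iff_map_eq_zero]
    intro x hx
    refine hev z hneg x ?_
    rw [← sub_eq_zero, ← hx]
    simp only [_root_.add_apply, _root_.sub_apply,
      _root_.smul_apply, ContinuousLinearMap.id_apply]
    abel
  have h3 : algebraMap ℝ (K →L[ℂ] K) z - (T + F)
      = -(T - (z : ℂ) • ContinuousLinearMap.id ℂ K + F) := by
    ext x
    simp [Algebra.algebraMap_eq_smul_one]
    abel
  rw [spectrum.mem_resolventSet_iff, h3]
  exact h2.neg

theorem inner_neg_of_mem_negSpace {A : K →L[ℂ] K} (hA : IsSelfAdjoint A) {f : K}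
    (hf : f ∈ negSpace A) (hf0 : f ≠ 0) : (inner ℂ (A f) f).re < 0 := by
  obtain ⟨g, hg, rfl⟩ := (Submodule.mem_iSup_iff_exists_finsupp _ _).mp hf
  have hsymm : (A : Module.End ℂ K).IsSymmetric := hA.isSymmetric
  have hort : ∀ i j : Set.Iio (0 : ℝ), i ≠ j → inner ℂ (g i) (g j) = 0 := by
    intro i j hij
    have hne : (((i : ℝ) : ℂ)) ≠ ((j : ℝ) : ℂ) := by
      simpa [Subtype.ext_iff] using hij
    exact hsymm.orthogonalFamily_eigenspaces hne ⟨g i, hg i⟩ ⟨g j, hg j⟩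
  have hAg : ∀ i, A (g i) = ((i : ℝ) : ℂ) • g i := fun i =>
    Module.End.mem_eigenspace_iff.mp (hg i)
  have key : inner ℂ (A (g.sum fun _ x => x)) (g.sum fun _ x => x)
      = ((∑ i ∈ g.support, (i : ℝ) * ‖g i‖ ^ 2 : ℝ) : ℂ) := by
    rw [Finsupp.sum, map_sum, sum_inner]
    push_cast
    refine Finset.sum_congr rfl fun i hi => ?_
    rw [inner_sum, Finset.sum_eq_single i]
    · rw [hAg, inner_smul_left, inner_self_eq_norm_sq_to_K]
      simp
    · intro j _ hj
      rw [hAg, inner_smul_left, hort i j hj.symm, mul_zero]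
    · intro h; exact absurd hi h
  rw [key, Complex.ofReal_re]
  have hne : g.support.Nonempty := by
    rw [Finset.nonempty_iff_ne_empty]
    intro h
    apply hf0
    rw [Finsupp.sum, h, Finset.sum_empty]
  refine Finset.sum_neg (fun i hi => ?_) hne
  have h1 : (i : ℝ) < 0 := i.2
  have h2 : 0 < ‖g i‖ := norm_pos_iff.mpr (Finsupp.mem_support_iff.mp hi)
  exact mul_neg_of_neg_of_pos h1 (by positivity)

/-- The variational count of negative eigenvalues: a form which is negative on an `n`-dimensional
space and nonnegative on a subspace of codimension `n` has exactly `n` negative eigenvalues. -/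
theorem eigenvalueCount_neg {T F : K →L[ℂ] K} (hT : T.IsPositive)
    (hF : F.toLinearMap.HasFiniteRange) (hS : IsSelfAdjoint (T + F))
    {ι : Type*} [Fintype ι] (w : (ι → ℂ) →ₗ[ℂ] K)
    (hw : ∀ c, c ≠ 0 → (inner ℂ ((T + F) (w c)) (w c)).re < 0)
    (l : K →ₗ[ℂ] (ι → ℂ)) (hl : ∀ f, l f = 0 → 0 ≤ (inner ℂ ((T + F) f) f).re) :
    eigenvalueCount (T + F) (Set.Iio 0) = Fintype.card ι := by
  obtain ⟨A, hAdef⟩ : ∃ A, A = T + F := ⟨_, rfl⟩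
  have hAx : ∀ x, A x = T x + F x := fun x => by rw [hAdef]; rfl
  rw [← hAdef] at hS hw hl ⊢
  have hlinj : Function.Injective (l ∘ₗ (negSpace A).subtype) := by
    rw [injective_iff_map_eq_zero]
    rintro ⟨f, hf⟩ h
    by_contra hne
    have h1 := inner_neg_of_mem_negSpace hS hf (fun h0 => hne (Subtype.ext h0))
    have h2 := hl f h
    linarith
  have hfin : FiniteDimensional ℂ (negSpace A) := Module.Finite.of_injective _ hlinj
  -- On the orthogonal complement the operator has no negative eigenvalue, hence is positive.
  have hsymm : ∀ x y, inner ℂ (A x) y = inner ℂ x (A y) := hS.isSymmetric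
  have hpos : ∀ f ∈ (negSpace A)ᗮ, 0 ≤ (inner ℂ (A f) f).re := by
    have hinv : ∀ f ∈ negSpace A, A f ∈ negSpace A := by
      intro f hf
      have : negSpace A ≤ (negSpace A).comap (A : K →ₗ[ℂ] K) := by
        conv_lhs => rw [negSpace]
        refine iSup_le fun z x hx => ?_
        have hx' : A x = ((z : ℝ) : ℂ) • x := Module.End.mem_eigenspace_iff.mp hx
        change A x ∈ negSpace A
        rw [hx']
        exact Submodule.smul_mem _ _ (Submodule.mem_iSup_of_mem z hx)
      exact this hf
    have hinv' : ∀ f ∈ (negSpace A)ᗮ, A f ∈ (negSpace A)ᗮ := by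
      intro f hf
      rw [Submodule.mem_orthogonal] at hf ⊢
      intro u hu
      rw [← hsymm]
      exact hf _ (hinv u hu)
    set U := (negSpace A)ᗮ
    have hcT := hT.orthogonalProjectionOnto_comp U
    have hcF : (U.orthogonalProjectionOnto ∘L F ∘L U.subtypeL).toLinearMap.HasFiniteRange :=
      (hF.comp_right _).comp_left _
    have hsum : U.orthogonalProjectionOnto ∘L T ∘L U.subtypeL
        + U.orthogonalProjectionOnto ∘L F ∘L U.subtypeL
        = U.orthogonalProjectionOnto ∘L A ∘L U.subtypeL := by
      ext x
      simp [hAx]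
    have hcA : ∀ x : U, ((U.orthogonalProjectionOnto ∘L A ∘L U.subtypeL) x : K) = A x := by
      intro x
      simp only [ContinuousLinearMap.comp_apply, Submodule.subtypeL_apply]
      exact congrArg Subtype.val
        (Submodule.orthogonalProjectionOnto_mem_subspace_eq_self (K := U) ⟨A x, hinv' x x.2⟩)
    have hcpos := isPositive_of_no_neg_eigenvalue hcT hcF (by
      rw [hsum, ContinuousLinearMap.isSelfAdjoint_iff_isSymmetric]
      intro x y
      change inner ℂ (((U.orthogonalProjectionOnto ∘L A ∘L U.subtypeL) x : U) : K) (y : K)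
        = inner ℂ (x : K) (((U.orthogonalProjectionOnto ∘L A ∘L U.subtypeL) y : U) : K)
      rw [hcA, hcA, hsymm]) (by
      intro z hz x hx
      rw [hsum] at hx
      have hx' : A x = (z : ℂ) • (x : K) := by rw [← hcA, hx]; rfl
      have hmem : (x : K) ∈ negSpace A :=
        Submodule.mem_iSup_of_mem (⟨z, hz⟩ : Set.Iio (0 : ℝ))
          (Module.End.mem_eigenspace_iff.mpr hx')
      exact Subtype.ext (inner_self_eq_zero.mp
        ((Submodule.mem_orthogonal _ _).mp x.2 _ hmem)))
    intro f hf
    have h1 := hcpos.re_inner_nonneg_left ⟨f, hf⟩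
    rw [hsum] at h1
    have h2 : (0 : ℝ) ≤ RCLike.re (inner ℂ
      (((U.orthogonalProjectionOnto ∘L A ∘L U.subtypeL) ⟨f, hf⟩ : U) : K) f) := h1
    rw [hcA] at h2
    exact h2
  have hwinj : Function.Injective
      ((negSpace A).orthogonalProjectionOnto.toLinearMap ∘ₗ w) := by
    rw [injective_iff_map_eq_zero]
    intro c hc
    by_contra hne
    have h1 : w c ∈ (negSpace A)ᗮ :=
      Submodule.orthogonalProjectionOnto_eq_zero_iff.mp hc
    have h2 := hpos _ h1
    have h3 := hw c hne
    linarith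
  have h1 := LinearMap.finrank_le_finrank_of_injective hlinj
  have h2 := LinearMap.finrank_le_finrank_of_injective hwinj
  rw [Module.finrank_fintype_fun_eq_card] at h1 h2
  rw [eigenvalueCount_eq_rank_negSpace, ← Module.finrank_eq_rank, le_antisymm h1 h2]
  simp

/-- The number of eigenvalues below the essential spectrum `⊆ [0, ∞)` with bottom `0`. -/
theorem numBelow_eq_card {T F : K →L[ℂ] K} (hT : T.IsPositive)
    (hF : F.toLinearMap.HasFiniteRange) (hS : IsSelfAdjoint (T + F))
    (hinj : Function.Injective T) (hT0 : ∀ C : ℝ, ∃ f : K, C * ‖T f‖ < ‖f‖)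
    {ι : Type*} [Fintype ι] (w : (ι → ℂ) →ₗ[ℂ] K)
    (hw : ∀ c, c ≠ 0 → (inner ℂ ((T + F) (w c)) (w c)).re < 0)
    (l : K →ₗ[ℂ] (ι → ℂ)) (hl : ∀ f, l f = 0 → 0 ≤ (inner ℂ ((T + F) f) f).re) :
    numBelow (T + F) = Fintype.card ι := by
  have h : {z : ℝ | ∀ w ∈ essSpectrum (T + F), z < w.re} = Set.Iio 0 := by
    ext z
    refine ⟨fun hz => ?_, fun hz w hw => lt_of_lt_of_le hz (essSpectrum_subset hT hF hw)⟩
    simpa using hz 0 (zero_mem_essSpectrum hT.isSelfAdjoint hF hinj hT0)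
  rw [numBelow, h]
  exact eigenvalueCount_neg hT hF hS w hw l hl

end Abstract

/-! ### The inertia of the reduced quadratic form -/

/-- The effective conductance, in the network of all edges of the square lattice that leave the
ball `|x₁| + |x₂| ≤ 2`, between the symmetry classes of `(2, 0)` and `(1, 1)`. -/
def kap : ℝ := (42 * Real.pi - 128) / (3 * (16 - 5 * Real.pi))

/-- The Dirichlet form of the square lattice reduced to the values `v 0, v 1, v 2, v 3` of a
symmetric function at `(0, 0)`, `(1, 0)`, `(2, 0)`, `(1, 1)`. -/
def traceForm (v : Fin 4 → ℝ) : ℝ :=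
  4 * (v 0 - v 1) ^ 2 + 4 * (v 1 - v 2) ^ 2 + 8 * (v 1 - v 3) ^ 2 + kap * (v 2 - v 3) ^ 2

/-- The energy form with the interaction included, reduced to the same four values. -/
def reducedForm (γ lam μ : ℝ) (v : Fin 4 → ℝ) : ℝ :=
  traceForm v + γ * v 0 ^ 2 + 2 * lam * v 1 ^ 2 + 2 * μ * (v 2 ^ 2 + v 3 ^ 2)

/-- The reduced form is diagonal, with exactly `n` negative entries, in some real coordinates. -/
def HasNegIndex (γ lam μ : ℝ) (n : ℕ) : Prop :=
  ∃ (X : Matrix (Fin 4) (Fin 4) ℝ) (d : Fin 4 → ℝ), (∀ v, X.mulVec v = 0 → v = 0) ∧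
    (∀ v, reducedForm γ lam μ v = ∑ i, d i * (X.mulVec v i) ^ 2) ∧
    Fintype.card {i // d i < 0} = n

theorem card_neg_fin_four (a b c d : ℝ) :
    Fintype.card {i // (![a, b, c, d] : Fin 4 → ℝ) i < 0} =
      (if a < 0 then 1 else 0) + (if b < 0 then 1 else 0) + (if c < 0 then 1 else 0)
        + (if d < 0 then 1 else 0) := by
  rw [Fintype.card_subtype, Finset.card_filter, Fin.sum_univ_four]
  congr

section Diagonalization

variable {γ lam μ t : ℝ}

/-- The Schur complement of the block of the coordinates `v 2`, `v 3`. -/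
def schur (lam μ t : ℝ) : ℝ :=
  16 + 2 * lam - 4 * (t + 3) ^ 2 / ((t ^ 2 + 1) * (μ + 3 + t))
    - 4 * (1 - 3 * t) ^ 2 / ((t ^ 2 + 1) * (μ + 3 - 1 / t))

theorem reducedForm_eq (γ lam μ : ℝ) (v : Fin 4 → ℝ) :
    reducedForm γ lam μ v = (γ + 4) * v 0 ^ 2 - 8 * v 0 * v 1
      + (16 + 2 * lam) * v 1 ^ 2 - 8 * v 1 * v 2 - 16 * v 1 * v 3
      + (4 + kap + 2 * μ) * v 2 ^ 2 - 2 * kap * v 2 * v 3 + (8 + kap + 2 * μ) * v 3 ^ 2 := by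
  rw [reducedForm, traceForm]; ring

/-- The block of `v 2`, `v 3` has the orthogonal eigenvectors `(t - 1, -(t + 1))` and
`(t + 1, t - 1)`, where `kap = t - 1 / t`. -/
theorem reducedForm_eq_eigen (γ lam μ : ℝ) (v : Fin 4 → ℝ) (ht : t ≠ 0)
    (hk : kap = t - 1 / t) :
    reducedForm γ lam μ v = (γ + 4) * v 0 ^ 2 - 8 * v 0 * v 1 + (16 + 2 * lam) * v 1 ^ 2
      + (4 * (t + 3) / (t ^ 2 + 1) * (v 1 * ((t - 1) * v 2 - (t + 1) * v 3))
        + (μ + 3 + t) / (t ^ 2 + 1) * ((t - 1) * v 2 - (t + 1) * v 3) ^ 2)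
      + (4 * (1 - 3 * t) / (t ^ 2 + 1) * (v 1 * ((t + 1) * v 2 + (t - 1) * v 3))
        + (μ + 3 - 1 / t) / (t ^ 2 + 1) * ((t + 1) * v 2 + (t - 1) * v 3) ^ 2) := by
  have hN : t ^ 2 + 1 ≠ 0 := by positivity
  rw [reducedForm_eq, hk]
  field_simp
  ring

theorem complete_square {N m b x y : ℝ} (hN : N ≠ 0) (hm : m ≠ 0) :
    4 * b / N * (x * y) + m / N * y ^ 2
      = m / N * (2 * b / m * x + y) ^ 2 - 4 * b ^ 2 / (N * m) * x ^ 2 := by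
  field_simp
  ring

/-- Diagonalization by completing squares in `v 2` and `v 3`, then in `v 1`, then in `v 0`. -/
theorem hasNegIndex_of_schur_ne_zero (ht : t ≠ 0) (hk : kap = t - 1 / t) (h1 : μ + 3 + t ≠ 0)
    (h2 : μ + 3 - 1 / t ≠ 0) (h3 : schur lam μ t ≠ 0) :
    HasNegIndex γ lam μ ((if μ + 3 + t < 0 then 1 else 0) + (if μ + 3 - 1 / t < 0 then 1 else 0)
      + (if schur lam μ t < 0 then 1 else 0)
      + (if γ + 4 - 16 / schur lam μ t < 0 then 1 else 0)) := by
  have hN : 0 < t ^ 2 + 1 := by positivity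
  refine ⟨!![0, 2 * (t + 3) / (μ + 3 + t), t - 1, -(t + 1);
      0, 2 * (1 - 3 * t) / (μ + 3 - 1 / t), t + 1, t - 1;
      -4 / schur lam μ t, 1, 0, 0; 1, 0, 0, 0],
    ![(μ + 3 + t) / (t ^ 2 + 1), (μ + 3 - 1 / t) / (t ^ 2 + 1), schur lam μ t,
      γ + 4 - 16 / schur lam μ t], ?_, ?_, ?_⟩
  · intro v hv
    have e0 := congrFun hv 0
    have e1 := congrFun hv 1
    have e2 := congrFun hv 2
    have e3 := congrFun hv 3
    simp only [Matrix.mulVec, dotProduct, Fin.sum_univ_four, Matrix.of_apply, Matrix.cons_val,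
      Pi.zero_apply, zero_mul, one_mul, zero_add, add_zero] at e0 e1 e2 e3
    rw [e3, mul_zero, zero_add] at e2
    rw [e2] at e0 e1
    have hv2 : v 2 = 0 := by
      have : (t ^ 2 + 1) * v 2 = 0 := by linear_combination ((t - 1) * e0 + (t + 1) * e1) / 2
      simpa [hN.ne'] using this
    have hv3 : v 3 = 0 := by
      have : (t ^ 2 + 1) * v 3 = 0 := by linear_combination ((t - 1) * e1 - (t + 1) * e0) / 2
      simpa [hN.ne'] using this
    ext i; fin_cases i <;> simp [e3, e2, hv2, hv3]
  · intro v
    have hS : (γ + 4) * v 0 ^ 2 - 8 * v 0 * v 1 + schur lam μ t * v 1 ^ 2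
        = schur lam μ t * (-4 / schur lam μ t * v 0 + v 1) ^ 2
          + (γ + 4 - 16 / schur lam μ t) * v 0 ^ 2 := by
      field_simp
      ring
    rw [reducedForm_eq_eigen γ lam μ v ht hk, complete_square hN.ne' h1,
      complete_square hN.ne' h2]
    simp only [Matrix.mulVec, dotProduct, Fin.sum_univ_four, Matrix.of_apply, Matrix.cons_val,
      zero_mul, one_mul, zero_add, add_zero]
    rw [schur] at hS ⊢
    linear_combination hS
  · rw [card_neg_fin_four]
    have : ∀ x : ℝ, x / (t ^ 2 + 1) < 0 ↔ x < 0 := fun x => by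
      rw [div_lt_iff₀ hN, zero_mul]
    simp only [this]

/-- When the Schur complement vanishes, the remaining two coordinates form a hyperbolic plane. -/
theorem hasNegIndex_of_schur_eq_zero (ht : t ≠ 0) (hk : kap = t - 1 / t) (h1 : μ + 3 + t ≠ 0)
    (h2 : μ + 3 - 1 / t ≠ 0) (h3 : schur lam μ t = 0) :
    HasNegIndex γ lam μ ((if μ + 3 + t < 0 then 1 else 0) + (if μ + 3 - 1 / t < 0 then 1 else 0)
      + 1) := by
  have hN : 0 < t ^ 2 + 1 := by positivity
  refine ⟨!![0, 2 * (t + 3) / (μ + 3 + t), t - 1, -(t + 1);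
      0, 2 * (1 - 3 * t) / (μ + 3 - 1 / t), t + 1, t - 1;
      1 + (γ + 4) / 2, -4, 0, 0; 1 - (γ + 4) / 2, 4, 0, 0],
    ![(μ + 3 + t) / (t ^ 2 + 1), (μ + 3 - 1 / t) / (t ^ 2 + 1), 1 / 2, -1 / 2], ?_, ?_, ?_⟩
  · intro v hv
    have e0 := congrFun hv 0
    have e1 := congrFun hv 1
    have e2 := congrFun hv 2
    have e3 := congrFun hv 3
    simp only [Matrix.mulVec, dotProduct, Fin.sum_univ_four, Matrix.of_apply, Matrix.cons_val,
      Pi.zero_apply, zero_mul, zero_add, add_zero] at e0 e1 e2 e3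
    have hv0 : v 0 = 0 := by linear_combination (e2 + e3) / 2
    have hv1 : v 1 = 0 := by
      rw [hv0] at e3
      linear_combination e3 / 4
    rw [hv1] at e0 e1
    have hv2 : v 2 = 0 := by
      have : (t ^ 2 + 1) * v 2 = 0 := by linear_combination ((t - 1) * e0 + (t + 1) * e1) / 2
      simpa [hN.ne'] using this
    have hv3 : v 3 = 0 := by
      have : (t ^ 2 + 1) * v 3 = 0 := by linear_combination ((t - 1) * e1 - (t + 1) * e0) / 2
      simpa [hN.ne'] using this
    ext i; fin_cases i <;> simp [hv0, hv1, hv2, hv3]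
  · intro v
    rw [reducedForm_eq_eigen γ lam μ v ht hk, complete_square hN.ne' h1,
      complete_square hN.ne' h2]
    simp only [Matrix.mulVec, dotProduct, Fin.sum_univ_four, Matrix.of_apply, Matrix.cons_val,
      zero_mul, zero_add, add_zero]
    rw [schur] at h3
    linear_combination v 1 ^ 2 * h3
  · rw [card_neg_fin_four]
    have : ∀ x : ℝ, x / (t ^ 2 + 1) < 0 ↔ x < 0 := fun x => by
      rw [div_lt_iff₀ hN, zero_mul]
    simp only [this]
    norm_num

/-- When one eigenvalue of the block of `v 2`, `v 3` vanishes, its eigenvector and `v 1` span a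
hyperbolic plane. Replacing `t` by `-1 / t` exchanges the two eigenvalues. -/
theorem hasNegIndex_of_eigenvalue_eq_zero (ht : t ≠ 0) (ht3 : 1 - 3 * t ≠ 0)
    (hk : kap = t - 1 / t) (h1 : μ + 3 + t ≠ 0) (h2 : μ + 3 - 1 / t = 0) :
    HasNegIndex γ lam μ ((if μ + 3 + t < 0 then 1 else 0) + 1
      + (if γ + 4 < 0 then 1 else 0)) := by
  have hN : 0 < t ^ 2 + 1 := by positivity
  set c := 16 + 2 * lam - 4 * (t + 3) ^ 2 / ((t ^ 2 + 1) * (μ + 3 + t)) with hc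
  set k := 2 * (1 - 3 * t) / (t ^ 2 + 1) with hkk
  have hk0 : k ≠ 0 := by rw [hkk]; positivity
  refine ⟨!![0, 2 * (t + 3) / (μ + 3 + t), t - 1, -(t + 1);
      -4, c / 2 + 1, k * (t + 1), k * (t - 1);
      4, 1 - c / 2, -(k * (t + 1)), -(k * (t - 1)); 1, 0, 0, 0],
    ![(μ + 3 + t) / (t ^ 2 + 1), 1 / 2, -1 / 2, γ + 4], ?_, ?_, ?_⟩
  · intro v hv
    have e0 := congrFun hv 0
    have e1 := congrFun hv 1
    have e2 := congrFun hv 2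
    have e3 := congrFun hv 3
    simp only [Matrix.mulVec, dotProduct, Fin.sum_univ_four, Matrix.of_apply, Matrix.cons_val,
      Pi.zero_apply, zero_mul, one_mul, zero_add, add_zero] at e0 e1 e2 e3
    have hv1 : v 1 = 0 := by linear_combination (e1 + e2) / 2
    rw [e3, hv1] at e1
    rw [hv1] at e0
    have e1' : (t + 1) * v 2 + (t - 1) * v 3 = 0 := by
      refine mul_left_cancel₀ hk0 ?_
      linear_combination e1
    have hv2 : v 2 = 0 := by
      have : (t ^ 2 + 1) * v 2 = 0 := by linear_combination ((t - 1) * e0 + (t + 1) * e1') / 2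
      simpa [hN.ne'] using this
    have hv3 : v 3 = 0 := by
      have : (t ^ 2 + 1) * v 3 = 0 := by linear_combination ((t - 1) * e1' - (t + 1) * e0) / 2
      simpa [hN.ne'] using this
    ext i; fin_cases i <;> simp [e3, hv1, hv2, hv3]
  · intro v
    rw [reducedForm_eq_eigen γ lam μ v ht hk, complete_square hN.ne' h1, h2]
    simp only [Matrix.mulVec, dotProduct, Fin.sum_univ_four, Matrix.of_apply, Matrix.cons_val,
      zero_mul, one_mul, zero_add, add_zero]
    have hk2 : 4 * (1 - 3 * t) / (t ^ 2 + 1) = 2 * k := by rw [hkk]; ring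
    have hlam : 16 + 2 * lam = c + 4 * (t + 3) ^ 2 / ((t ^ 2 + 1) * (μ + 3 + t)) := by
      rw [hc]; ring
    rw [hk2, hlam]
    ring
  · rw [card_neg_fin_four]
    have : ∀ x : ℝ, x / (t ^ 2 + 1) < 0 ↔ x < 0 := fun x => by
      rw [div_lt_iff₀ hN, zero_mul]
    simp only [this]
    norm_num

end Diagonalization

/-! ### The roots `μ₀^±` and the regions of the parameter space -/

/-- The larger root of `t - 1 / t = kap`; it makes `μ₀^±` rational: `μ₀⁻ = -3 - t` and
`μ₀⁺ = -3 + 1 / t`. -/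
def tPar : ℝ := (kap + √(kap ^ 2 + 4)) / 2

theorem sixteen_sub_pos : 0 < 16 - 5 * Real.pi := by linarith [Real.pi_lt_d2]

theorem kap_mul : kap * (3 * (16 - 5 * Real.pi)) = 42 * Real.pi - 128 :=
  div_mul_cancel₀ _ (mul_pos (by norm_num) sixteen_sub_pos).ne'

theorem kap_pos : 0 < kap :=
  div_pos (by linarith [Real.pi_gt_d2]) (mul_pos (by norm_num) sixteen_sub_pos)

theorem tPar_gt_one : 1 < tPar := by
  have h1 : (2 : ℝ) ≤ √(kap ^ 2 + 4) := Real.le_sqrt_of_sq_le (by nlinarith [kap_pos])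
  rw [tPar]
  linarith [kap_pos]

theorem tPar_sq : tPar ^ 2 = kap * tPar + 1 := by
  have h := Real.sq_sqrt (by positivity : 0 ≤ kap ^ 2 + 4)
  rw [tPar]
  linear_combination h / 4

theorem kap_eq : kap = tPar - 1 / tPar := by
  have := tPar_gt_one
  field_simp
  linear_combination -tPar_sq

theorem sqrt_mu0 : √(666 * Real.pi ^ 2 - 4128 * Real.pi + 6400)
    = 3 * (16 - 5 * Real.pi) * √(kap ^ 2 + 4) / 2 := by
  have hw := sixteen_sub_pos
  have h : 666 * Real.pi ^ 2 - 4128 * Real.pi + 6400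
      = (3 * (16 - 5 * Real.pi) * √(kap ^ 2 + 4) / 2) ^ 2 := by
    rw [div_pow, mul_pow, Real.sq_sqrt (by positivity)]
    linear_combination
      -(kap * (3 * (16 - 5 * Real.pi)) + 42 * Real.pi - 128) / 4 * kap_mul
  rw [h, Real.sqrt_sq (by positivity)]

theorem mu0m_eq : mu0m = -(3 + tPar) := by
  have hw := sixteen_sub_pos
  rw [mu0m, sqrt_mu0, tPar, div_eq_iff (by positivity)]
  linear_combination kap_mul / 2

theorem mu0p_eq : mu0p = -(3 - 1 / tPar) := by
  have hw := sixteen_sub_pos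
  have h : 1 / tPar = tPar - kap := by rw [kap_eq]; ring
  rw [h, mu0p, sqrt_mu0, tPar, div_eq_iff (by positivity)]
  linear_combination kap_mul / 2

theorem mu0m_lt_mu0p : mu0m < mu0p := by
  rw [mu0m_eq, mu0p_eq]
  have := tPar_gt_one
  have : 0 < 1 / tPar := by positivity
  linarith

theorem Q0_eq (μ : ℝ) : Q0 (-1) μ
    = (16 - 5 * Real.pi) / (4 * Real.pi) * ((μ + 3 + tPar) * (μ + 3 - 1 / tPar)) := by
  rw [Q0, mu0m_eq, mu0p_eq]; ring

theorem Q1_eq (μ : ℝ) : Q1 (-1) μ = (16 - 5 * Real.pi) / (4 * Real.pi)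
    * (8 * (μ ^ 2 + (7 / 2 + kap) * μ + (2 + 3 / 4 * kap))) := by
  have hw := sixteen_sub_pos
  have hsq : √(801 * Real.pi ^ 2 - 4512 * Real.pi + 6400) ^ 2
      = 801 * Real.pi ^ 2 - 4512 * Real.pi + 6400 :=
    Real.sq_sqrt (by nlinarith [sq_nonneg (801 * Real.pi - 2256)])
  have h1 : mu1m + mu1p = -(7 / 2 + kap) := by
    rw [mu1m, mu1p, kap]
    obtain ⟨w, hwp⟩ : ∃ w, w = 16 - 5 * Real.pi := ⟨_, rfl⟩
    rw [← hwp] at hw ⊢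
    field_simp
    rw [hwp]
    ring
  have h2 : mu1m * mu1p = 2 + 3 / 4 * kap := by
    rw [mu1m, mu1p, kap, div_mul_div_comm, div_eq_iff (by positivity)]
    generalize √(801 * Real.pi ^ 2 - 4512 * Real.pi + 6400) = r at hsq
    obtain ⟨w, hwp⟩ : ∃ w, w = 16 - 5 * Real.pi := ⟨_, rfl⟩
    rw [← hwp] at hw ⊢
    field_simp
    rw [hwp]
    linear_combination -4 * hsq
  rw [← h2]
  have h3 : 7 / 2 + kap = -(mu1m + mu1p) := by rw [h1]; ring
  rw [h3, Q1]
  field_simp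
  ring

section Regions

variable {γ lam μ : ℝ}

theorem schur_eq (h1 : μ + 3 + tPar ≠ 0) (h2 : μ + 3 - 1 / tPar ≠ 0) :
    schur lam μ tPar = 2 * (lam - lamCurve (-1) μ) := by
  have hw := sixteen_sub_pos
  have ht := tPar_gt_one
  have hc : (16 - 5 * Real.pi) / (4 * Real.pi) ≠ 0 := by positivity
  have hN : tPar ^ 2 + 1 ≠ 0 := by positivity
  rw [lamCurve, Q0_eq, Q1_eq, mul_div_mul_left _ _ hc, schur, kap_eq]
  obtain ⟨p, hp⟩ : ∃ p, p = μ + 3 + tPar := ⟨_, rfl⟩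
  obtain ⟨q, hq⟩ : ∃ q, q = μ + 3 - 1 / tPar := ⟨_, rfl⟩
  rw [← hp] at h1 ⊢
  rw [← hq] at h2 ⊢
  field_simp
  rw [hp, hq]
  field_simp
  ring

theorem Q0_ne_zero (h1 : μ + 3 + tPar ≠ 0) (h2 : μ + 3 - 1 / tPar ≠ 0) : Q0 (-1) μ ≠ 0 := by
  have hw := sixteen_sub_pos
  rw [Q0_eq]
  positivity

theorem gamSurf_eq (h1 : μ + 3 + tPar ≠ 0) (h2 : μ + 3 - 1 / tPar ≠ 0) :
    gamSurf (-1) lam μ = 16 / schur lam μ tPar - 4 := by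
  have hQ := Q0_ne_zero h1 h2
  have h : lam * Q0 (-1) μ - -1 * Q1 (-1) μ
      = Q0 (-1) μ * (lam - lamCurve (-1) μ) := by
    rw [lamCurve]
    field_simp
  rw [schur_eq h1 h2, gamSurf, h, mul_comm 8, mul_div_mul_left _ _ hQ]
  by_cases h0 : lam - lamCurve (-1) μ = 0
  · rw [h0]; norm_num
  · field_simp
    ring

theorem gamSurf_eq_of_root (h : Q0 (-1) μ = 0) : gamSurf (-1) lam μ = -4 := by
  rw [gamSurf, h]; norm_num

/-- Off the surface `γ = γ⁻(λ, μ)` and the cylinder `λ = λ⁻(μ)`, over `μ ≠ μ₀^±`. -/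
theorem hasNegIndex_regular (h1 : μ + 3 + tPar ≠ 0) (h2 : μ + 3 - 1 / tPar ≠ 0)
    (h3 : lam ≠ lamCurve (-1) μ) :
    HasNegIndex γ lam μ ((if μ < mu0m then 1 else 0) + (if μ < mu0p then 1 else 0)
      + (if lam < lamCurve (-1) μ then 1 else 0)
      + (if γ < gamSurf (-1) lam μ then 1 else 0)) := by
  have hs := schur_eq (lam := lam) h1 h2
  have hs0 : schur lam μ tPar ≠ 0 := by
    rw [hs]
    exact mul_ne_zero two_ne_zero (sub_ne_zero.mpr h3)
  have := hasNegIndex_of_schur_ne_zero (γ := γ) (by linarith [tPar_gt_one]) kap_eq h1 h2 hs0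
  have e1 : μ + 3 + tPar < 0 ↔ μ < mu0m := by rw [mu0m_eq]; constructor <;> intro <;> linarith
  have e2 : μ + 3 - 1 / tPar < 0 ↔ μ < mu0p := by rw [mu0p_eq]; constructor <;> intro <;> linarith
  have e3 : schur lam μ tPar < 0 ↔ lam < lamCurve (-1) μ := by
    rw [hs]; constructor <;> intro <;> linarith
  have e4 : γ + 4 - 16 / schur lam μ tPar < 0 ↔ γ < gamSurf (-1) lam μ := by
    rw [gamSurf_eq h1 h2]; constructor <;> intro <;> linarith
  simpa only [e1, e2, e3, e4] using this

theorem hasNegIndex_curve (h1 : μ + 3 + tPar ≠ 0) (h2 : μ + 3 - 1 / tPar ≠ 0)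
    (h3 : lam = lamCurve (-1) μ) :
    HasNegIndex γ lam μ ((if μ < mu0m then 1 else 0) + (if μ < mu0p then 1 else 0) + 1) := by
  have hs := schur_eq (lam := lam) h1 h2
  rw [h3, sub_self, mul_zero, ← h3] at hs
  have := hasNegIndex_of_schur_eq_zero (γ := γ) (by linarith [tPar_gt_one]) kap_eq h1 h2 hs
  have e1 : μ + 3 + tPar < 0 ↔ μ < mu0m := by rw [mu0m_eq]; constructor <;> intro <;> linarith
  have e2 : μ + 3 - 1 / tPar < 0 ↔ μ < mu0p := by rw [mu0p_eq]; constructor <;> intro <;> linarith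
  simpa only [e1, e2] using this

theorem hasNegIndex_mu0p (h : μ = mu0p) :
    HasNegIndex γ lam μ (1 + (if γ < gamSurf (-1) lam μ then 1 else 0)) := by
  have ht := tPar_gt_one
  have h2 : μ + 3 - 1 / tPar = 0 := by rw [h, mu0p_eq]; ring
  have hpos : 0 < 1 / tPar := by positivity
  have h1 : 0 < μ + 3 + tPar := by linarith
  have := hasNegIndex_of_eigenvalue_eq_zero (γ := γ) (lam := lam) (by linarith)
    (by linarith) kap_eq h1.ne' h2
  rw [if_neg (not_lt.mpr h1.le), zero_add] at this
  have e : γ + 4 < 0 ↔ γ < gamSurf (-1) lam μ := by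
    rw [gamSurf_eq_of_root (by rw [Q0_eq, h2]; ring)]; constructor <;> intro <;> linarith
  simpa only [e] using this

theorem hasNegIndex_mu0m (h : μ = mu0m) :
    HasNegIndex γ lam μ (2 + (if γ < gamSurf (-1) lam μ then 1 else 0)) := by
  have ht := tPar_gt_one
  have hpos : 0 < 1 / tPar := by positivity
  have h2 : μ + 3 + tPar = 0 := by rw [h, mu0m_eq]; ring
  have h1 : μ + 3 + -(1 / tPar) < 0 := by linarith
  have hinv : 1 / -(1 / tPar) = -tPar := by field_simp
  have := hasNegIndex_of_eigenvalue_eq_zero (γ := γ) (lam := lam) (μ := μ) (t := -(1 / tPar))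
    (by linarith) (by linarith) (by rw [hinv, kap_eq]; ring) h1.ne (by rw [hinv]; linarith)
  rw [if_pos h1] at this
  have e : γ + 4 < 0 ↔ γ < gamSurf (-1) lam μ := by
    rw [gamSurf_eq_of_root (by rw [Q0_eq, h2]; ring)]; constructor <;> intro <;> linarith
  simpa only [e] using this

theorem ne_of_mem_I1 (h : μ ∈ I1 (-1)) :
    μ + 3 + tPar ≠ 0 ∧ μ + 3 - 1 / tPar ≠ 0 ∧ ¬ μ < mu0m ∧ ¬ μ < mu0p := by
  have h' : -1 * μ < -mu0p := h
  have := mu0m_lt_mu0p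
  have h1 := mu0m_eq
  have h2 := mu0p_eq
  refine ⟨fun _ => ?_, fun _ => ?_, fun _ => ?_, fun _ => ?_⟩ <;> linarith

theorem ne_of_mem_I2 (h : μ ∈ I2 (-1)) :
    μ + 3 + tPar ≠ 0 ∧ μ + 3 - 1 / tPar ≠ 0 ∧ ¬ μ < mu0m ∧ μ < mu0p := by
  obtain ⟨h', h''⟩ : -mu0p < -1 * μ ∧ -1 * μ < -mu0m := h
  have h1 := mu0m_eq
  have h2 := mu0p_eq
  refine ⟨fun _ => ?_, fun _ => ?_, fun _ => ?_, ?_⟩ <;> linarith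

theorem ne_of_mem_I3 (h : μ ∈ I3 (-1)) :
    μ + 3 + tPar ≠ 0 ∧ μ + 3 - 1 / tPar ≠ 0 ∧ μ < mu0m ∧ μ < mu0p := by
  have h' : -mu0m < -1 * μ := h
  have := mu0m_lt_mu0p
  have h1 := mu0m_eq
  have h2 := mu0p_eq
  refine ⟨fun _ => ?_, fun _ => ?_, ?_, ?_⟩ <;> linarith

/-- On an interval `I` where `a` and `b` count the negative eigenvalues of the block of `v 2`,
`v 3`, a positive Schur complement adds nothing to the index. -/
theorem hasNegIndex_before {I : Set ℝ} {a b : ℕ}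
    (hI : ∀ μ ∈ I, μ + 3 + tPar ≠ 0 ∧ μ + 3 - 1 / tPar ≠ 0 ∧
      (if μ < mu0m then 1 else 0) = a ∧ (if μ < mu0p then 1 else 0) = b)
    (h : (lam, μ) ∈ before (-1) I) :
    HasNegIndex γ lam μ (a + b + (if γ < gamSurf (-1) lam μ then 1 else 0)) := by
  obtain ⟨hμ, hl⟩ : μ ∈ I ∧ -1 * lam < -1 * lamCurve (-1) μ := h
  obtain ⟨h1, h2, ha, hb⟩ := hI μ hμ
  have := hasNegIndex_regular (γ := γ) (lam := lam) h1 h2 (by intro h; rw [h] at hl; linarith)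
  rwa [ha, hb, if_neg (c := lam < lamCurve (-1) μ) (by linarith)] at this

/-- A negative Schur complement raises the index by one. -/
theorem hasNegIndex_beyond {I : Set ℝ} {a b : ℕ}
    (hI : ∀ μ ∈ I, μ + 3 + tPar ≠ 0 ∧ μ + 3 - 1 / tPar ≠ 0 ∧
      (if μ < mu0m then 1 else 0) = a ∧ (if μ < mu0p then 1 else 0) = b)
    (h : (lam, μ) ∈ beyond (-1) I) :
    HasNegIndex γ lam μ (a + b + 1 + (if γ < gamSurf (-1) lam μ then 1 else 0)) := by
  obtain ⟨hμ, hl⟩ : μ ∈ I ∧ -1 * lamCurve (-1) μ < -1 * lam := h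
  obtain ⟨h1, h2, ha, hb⟩ := hI μ hμ
  have := hasNegIndex_regular (γ := γ) (lam := lam) h1 h2 (by intro h; rw [h] at hl; linarith)
  rwa [ha, hb, if_pos (c := lam < lamCurve (-1) μ) (by linarith)] at this

theorem hasNegIndex_tau {I : Set ℝ} {a b : ℕ}
    (hI : ∀ μ ∈ I, μ + 3 + tPar ≠ 0 ∧ μ + 3 - 1 / tPar ≠ 0 ∧
      (if μ < mu0m then 1 else 0) = a ∧ (if μ < mu0p then 1 else 0) = b)
    (h : (lam, μ) ∈ tau (-1) I) : HasNegIndex γ lam μ (a + b + 1) := by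
  obtain ⟨hμ, hl⟩ : μ ∈ I ∧ lam = lamCurve (-1) μ := h
  obtain ⟨h1, h2, ha, hb⟩ := hI μ hμ
  have := hasNegIndex_curve (γ := γ) (lam := lam) h1 h2 hl
  rwa [ha, hb] at this

theorem ite_of_mem_I1 (μ : ℝ) (h : μ ∈ I1 (-1)) : μ + 3 + tPar ≠ 0 ∧ μ + 3 - 1 / tPar ≠ 0 ∧
    (if μ < mu0m then 1 else 0) = 0 ∧ (if μ < mu0p then 1 else 0) = 0 := by
  obtain ⟨h1, h2, h3, h4⟩ := ne_of_mem_I1 h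
  exact ⟨h1, h2, if_neg h3, if_neg h4⟩

theorem ite_of_mem_I2 (μ : ℝ) (h : μ ∈ I2 (-1)) : μ + 3 + tPar ≠ 0 ∧ μ + 3 - 1 / tPar ≠ 0 ∧
    (if μ < mu0m then 1 else 0) = 0 ∧ (if μ < mu0p then 1 else 0) = 1 := by
  obtain ⟨h1, h2, h3, h4⟩ := ne_of_mem_I2 h
  exact ⟨h1, h2, if_neg h3, if_pos h4⟩

theorem ite_of_mem_I3 (μ : ℝ) (h : μ ∈ I3 (-1)) : μ + 3 + tPar ≠ 0 ∧ μ + 3 - 1 / tPar ≠ 0 ∧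
    (if μ < mu0m then 1 else 0) = 1 ∧ (if μ < mu0p then 1 else 0) = 1 := by
  obtain ⟨h1, h2, h3, h4⟩ := ne_of_mem_I3 h
  exact ⟨h1, h2, if_pos h3, if_pos h4⟩

theorem hasNegIndex_D1 (h : (lam, μ) ∈ D1 (-1)) :
    HasNegIndex γ lam μ (0 + (if γ < gamSurf (-1) lam μ then 1 else 0)) :=
  hasNegIndex_before ite_of_mem_I1 h

theorem hasNegIndex_D2 (h : (lam, μ) ∈ D2 (-1)) :
    HasNegIndex γ lam μ (1 + (if γ < gamSurf (-1) lam μ then 1 else 0)) := by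
  rcases h with (h | h) | h
  · exact hasNegIndex_beyond ite_of_mem_I1 h
  · exact hasNegIndex_mu0p (by simpa using h)
  · exact hasNegIndex_before ite_of_mem_I2 h

theorem hasNegIndex_D3 (h : (lam, μ) ∈ D3 (-1)) :
    HasNegIndex γ lam μ (2 + (if γ < gamSurf (-1) lam μ then 1 else 0)) := by
  rcases h with (h | h) | h
  · exact hasNegIndex_beyond ite_of_mem_I2 h
  · exact hasNegIndex_mu0m (by simpa using h)
  · exact hasNegIndex_before ite_of_mem_I3 h

theorem hasNegIndex_D4 (h : (lam, μ) ∈ D4 (-1)) :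
    HasNegIndex γ lam μ (3 + (if γ < gamSurf (-1) lam μ then 1 else 0)) :=
  hasNegIndex_beyond ite_of_mem_I3 h

theorem hasNegIndex_before3 {D : Set (ℝ × ℝ)} {n : ℕ}
    (hD : (lam, μ) ∈ D → HasNegIndex γ lam μ (n + (if γ < gamSurf (-1) lam μ then 1 else 0)))
    (h : (γ, lam, μ) ∈ before3 (-1) D) : HasNegIndex γ lam μ n := by
  obtain ⟨h1, h2⟩ : (lam, μ) ∈ D ∧ -1 * γ < -1 * gamSurf (-1) lam μ := h
  have := hD h1
  rwa [if_neg (by linarith), add_zero] at this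

theorem hasNegIndex_beyond3 {D : Set (ℝ × ℝ)} {n : ℕ}
    (hD : (lam, μ) ∈ D → HasNegIndex γ lam μ (n + (if γ < gamSurf (-1) lam μ then 1 else 0)))
    (h : (γ, lam, μ) ∈ beyond3 (-1) D) : HasNegIndex γ lam μ (n + 1) := by
  obtain ⟨h1, h2⟩ : (lam, μ) ∈ D ∧ -1 * gamSurf (-1) lam μ < -1 * γ := h
  have := hD h1
  rwa [if_pos (by linarith)] at this

/-- On the component `𝒞_ζ⁻` the reduced form has exactly `ζ` negative squares. -/
theorem hasNegIndex_of_mem_component (ζ : Fin 5) (h : (γ, lam, μ) ∈ component (-1) ζ) :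
    HasNegIndex γ lam μ ζ := by
  fin_cases ζ
  · exact hasNegIndex_before3 hasNegIndex_D1 h
  · rcases h with (h | h) | h
    · exact hasNegIndex_beyond3 hasNegIndex_D1 h
    · exact hasNegIndex_tau ite_of_mem_I1 h
    · exact hasNegIndex_before3 hasNegIndex_D2 h
  · rcases h with (h | h) | h
    · exact hasNegIndex_beyond3 hasNegIndex_D2 h
    · exact hasNegIndex_tau ite_of_mem_I2 h
    · exact hasNegIndex_before3 hasNegIndex_D3 h
  · rcases h with (h | h) | h
    · exact hasNegIndex_beyond3 hasNegIndex_D3 h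
    · exact hasNegIndex_tau ite_of_mem_I3 h
    · exact hasNegIndex_before3 hasNegIndex_D4 h
  · exact hasNegIndex_beyond3 hasNegIndex_D4 h

end Regions

/-! ### Integrals over the circle and the torus -/

theorem integral_circ (f : Circ → ℝ) :
    ∫ x : Circ, f x = ∫ x in (0 : ℝ)..(2 * Real.pi), f (x : Circ) := by
  rw [← AddCircle.intervalIntegral_preimage (2 * Real.pi) 0, zero_add]

theorem integral_circ_one : ∫ _ : Circ, (1 : ℝ) = 2 * Real.pi := by
  rw [integral_circ]; simp

theorem integral_circ_cos : ∫ x : Circ, cosC x = 0 := by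
  rw [integral_circ]; simp [cosC_coe]

theorem integral_circ_cos_sq : ∫ x : Circ, cosC x ^ 2 = Real.pi := by
  rw [integral_circ]; simp [cosC_coe, integral_cos_sq]

theorem integral_circ_cos_cube : ∫ x : Circ, cosC x ^ 3 = 0 := by
  rw [integral_circ]; simp [cosC_coe, integral_cos_pow_three]

theorem cosC_two_nsmul (x : Circ) : cosC ((2 : ℕ) • x) = 2 * cosC x ^ 2 - 1 := by
  induction x using QuotientAddGroup.induction_on with
  | H z =>
    have : ((2 : ℕ) • (z : Circ)) = ((2 * z : ℝ) : Circ) := by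
      rw [← AddCircle.coe_nsmul]; simp
    change cosC ((2 : ℕ) • (z : Circ)) = 2 * cosC (z : Circ) ^ 2 - 1
    rw [this, cosC_coe, cosC_coe, Real.cos_two_mul]

theorem cosC_le_one (x : Circ) : cosC x ≤ 1 := by
  induction x using QuotientAddGroup.induction_on with
  | H z => exact Real.cos_le_one z

theorem eq_zero_of_cosC_eq_one {x : Circ} (h : cosC x = 1) : x = 0 := by
  induction x using QuotientAddGroup.induction_on with
  | H z =>
    obtain ⟨n, hn⟩ := (Real.cos_eq_one_iff z).mp h
    change ((z : ℝ) : Circ) = 0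
    rw [AddCircle.coe_eq_zero_iff]
    exact ⟨n, by simpa using hn⟩

theorem integrable_circ {f : Circ → ℝ} (hf : Continuous f) : Integrable f :=
  hf.integrable_of_hasCompactSupport (HasCompactSupport.of_compactSpace f)

theorem integrable_torus {f : Torus2 → ℝ} (hf : Continuous f) : Integrable f :=
  hf.integrable_of_hasCompactSupport (HasCompactSupport.of_compactSpace f)

/-- The resolvent kernel of the one-dimensional lattice at the origin, read off from the mean
value property of the Poisson kernel with pole `A - √(A² - 1)`. -/
theorem integral_circ_inv {A : ℝ} (hA : 1 < A) :
    ∫ x : Circ, (A - cosC x)⁻¹ = 2 * Real.pi / √(A ^ 2 - 1) := by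
  have hS : 0 < A ^ 2 - 1 := by nlinarith
  set S := √(A ^ 2 - 1) with hSdef
  have hS0 : 0 < S := Real.sqrt_pos.mpr hS
  have hS2 : S ^ 2 = A ^ 2 - 1 := Real.sq_sqrt hS.le
  set r := A - S with hr
  have hr0 : 0 < r := by nlinarith
  have hr1 : r < 1 := by nlinarith
  have hq : r ^ 2 + 1 = 2 * A * r := by rw [hr]; linear_combination hS2
  have hmean := DiffContOnCl.circleAverage_poissonKernel_smul (c := 0) (R := 1) (w := (r : ℂ))
    (f := fun _ : ℂ => (1 : ℂ)) diffContOnCl_const (by simp [abs_of_pos hr0, hr1])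
  have hk : ∀ θ : ℝ, poissonKernel 0 (r : ℂ) (circleMap 0 1 θ) = S * (A - Real.cos θ)⁻¹ := by
    intro θ
    have h1 : ‖circleMap 0 1 θ‖ = 1 := by simp
    have h2 : ‖circleMap 0 1 θ - (r : ℂ)‖ ^ 2 = 2 * r * (A - Real.cos θ) := by
      rw [← Complex.normSq_eq_norm_sq, Complex.normSq_apply]
      simp [circleMap, Complex.exp_re, Complex.exp_im]
      linear_combination Real.sin_sq_add_cos_sq θ + hq
    have h3 : A - Real.cos θ ≠ 0 := by linarith [Real.cos_le_one θ]
    have h4 : (1 : ℝ) - r ^ 2 = 2 * r * S := by rw [hr]; linear_combination hS2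
    rw [poissonKernel_def]
    simp only [sub_zero]
    rw [h1, h2, Complex.norm_real, Real.norm_eq_abs, sq_abs, one_pow, h4]
    field_simp
  rw [Real.circleAverage_def] at hmean
  simp only [Pi.smul_apply', hk, Complex.real_smul, mul_one] at hmean
  rw [intervalIntegral.integral_ofReal] at hmean
  have h5 : (2 * Real.pi)⁻¹ * ∫ θ in (0 : ℝ)..(2 * Real.pi), S * (A - Real.cos θ)⁻¹ = 1 := by
    exact_mod_cast hmean
  rw [intervalIntegral.integral_const_mul] at h5
  rw [integral_circ]
  simp only [cosC_coe]
  have hpi := Real.pi_pos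
  field_simp at h5 ⊢
  linarith

/-- The function `1 - cos` on the circle. -/
def oneSubCos (x : Circ) : ℝ := 1 - cosC x

theorem continuous_oneSubCos : Continuous oneSubCos := by unfold oneSubCos; fun_prop

theorem oneSubCos_nonneg (x : Circ) : 0 ≤ oneSubCos x := sub_nonneg.mpr (cosC_le_one x)

theorem integral_inv_add {c : ℝ} (hc : 0 < c) :
    ∫ x : Circ, (c + oneSubCos x)⁻¹ = 2 * Real.pi / √(c ^ 2 + 2 * c) := by
  have h := integral_circ_inv (A := 1 + c) (by linarith)
  have h2 : (1 + c) ^ 2 - 1 = c ^ 2 + 2 * c := by ring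
  rw [h2] at h
  rw [← h]
  congr 1
  ext x
  rw [oneSubCos]
  ring_nf

theorem integral_oneSubCos : ∫ x : Circ, oneSubCos x = 2 * Real.pi := by
  simp only [oneSubCos]
  rw [integral_sub (integrable_circ continuous_const) (integrable_circ (by fun_prop)),
    integral_circ_one, integral_circ_cos, sub_zero]

theorem integral_oneSubCos_sq : ∫ x : Circ, oneSubCos x ^ 2 = 3 * Real.pi := by
  have h : ∀ x : Circ, oneSubCos x ^ 2 = 1 - 2 * cosC x + cosC x ^ 2 := fun x => by
    rw [oneSubCos]; ring
  simp only [h]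
  rw [integral_add (integrable_circ (by fun_prop)) (integrable_circ (by fun_prop)),
    integral_sub (integrable_circ continuous_const) (integrable_circ (by fun_prop)),
    integral_const_mul, integral_circ_one, integral_circ_cos, integral_circ_cos_sq]
  ring

theorem integral_oneSubCos_cube : ∫ x : Circ, oneSubCos x ^ 3 = 5 * Real.pi := by
  have h : ∀ x : Circ, oneSubCos x ^ 3 = 1 - 3 * cosC x + 3 * cosC x ^ 2 - cosC x ^ 3 :=
    fun x => by rw [oneSubCos]; ring
  simp only [h]
  rw [integral_sub (integrable_circ (by fun_prop)) (integrable_circ (by fun_prop)),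
    integral_add (integrable_circ (by fun_prop)) (integrable_circ (by fun_prop)),
    integral_sub (integrable_circ continuous_const) (integrable_circ (by fun_prop)),
    integral_const_mul, integral_const_mul, integral_circ_one, integral_circ_cos,
    integral_circ_cos_sq, integral_circ_cos_cube]
  ring

theorem oneSubCos_coe (z : ℝ) : oneSubCos (z : Circ) = 2 * Real.sin (z / 2) ^ 2 := by
  rw [oneSubCos, cosC_coe, Real.sin_sq, ← mul_div_cancel₀ z (two_ne_zero' ℝ), Real.cos_two_mul]
  rw [mul_div_cancel₀ z (two_ne_zero' ℝ)]
  ring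

/-- With `y = cos (x / 2)` and `S = y √(2 - y²)`, an antiderivative is `-8 (S - S³ / 3)`. -/
theorem integral_quartic_div_sqrt :
    ∫ x : Circ, oneSubCos x ^ 4 / √(oneSubCos x ^ 2 + 2 * oneSubCos x) = 32 / 3 := by
  rw [integral_circ]
  have hderiv : ∀ z ∈ Set.uIcc (0 : ℝ) (2 * Real.pi),
      HasDerivAt (fun z : ℝ => -8 * (Real.cos (z / 2) * √(2 - Real.cos (z / 2) ^ 2)
          - (Real.cos (z / 2) * √(2 - Real.cos (z / 2) ^ 2)) ^ 3 / 3))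
        (8 * Real.sin (z / 2) ^ 7 / √(1 + Real.sin (z / 2) ^ 2)) z := by
    intro z _
    have hpos : 0 < 2 - Real.cos (z / 2) ^ 2 := by nlinarith [Real.cos_sq_le_one (z / 2)]
    have hy : HasDerivAt (fun z : ℝ => Real.cos (z / 2)) (-Real.sin (z / 2) * (1 / 2)) z :=
      ((hasDerivAt_id z).div_const 2).cos
    have hw : HasDerivAt (fun z : ℝ => √(2 - Real.cos (z / 2) ^ 2)) _ z :=
      ((hy.pow 2).const_sub 2).sqrt hpos.ne'
    have hS := hy.mul hw
    have hF := ((hS.sub ((hS.pow 3).div_const 3)).const_mul (-8))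
    refine hF.congr_deriv ?_
    have hs : 1 + Real.sin (z / 2) ^ 2 = 2 - Real.cos (z / 2) ^ 2 := by
      rw [Real.sin_sq]; ring
    rw [hs]
    have hsq : √(2 - Real.cos (z / 2) ^ 2) ^ 2 = 2 - Real.cos (z / 2) ^ 2 :=
      Real.sq_sqrt hpos.le
    have hsp : 0 < √(2 - Real.cos (z / 2) ^ 2) := Real.sqrt_pos.mpr hpos
    have hsc := Real.sin_sq (z / 2)
    simp only [Pi.mul_apply]
    generalize √(2 - Real.cos (z / 2) ^ 2) = w at hsq hsp
    generalize Real.cos (z / 2) = y at hsq hsc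
    generalize Real.sin (z / 2) = s at hsc
    have hy2 : y ^ 2 = 1 - s ^ 2 := by linarith
    have hw2 : w ^ 2 = 1 + s ^ 2 := by linarith
    have e1 : -(2 * w ^ 2) + 2 * y ^ 2 = -4 * s ^ 2 := by rw [hy2, hw2]; ring
    have e2 : 3 - 3 * (w * y) ^ 2 = 3 * s ^ 4 := by rw [mul_pow, hy2, hw2]; ring
    field_simp
    push_cast
    linear_combination -s * (3 - 3 * (w * y) ^ 2) * e1 + 4 * s ^ 3 * e2
  have hint : ∀ z ∈ Set.uIcc (0 : ℝ) (2 * Real.pi),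
      oneSubCos (z : Circ) ^ 4 / √(oneSubCos (z : Circ) ^ 2 + 2 * oneSubCos (z : Circ))
        = 8 * Real.sin (z / 2) ^ 7 / √(1 + Real.sin (z / 2) ^ 2) := by
    intro z hz
    rw [Set.uIcc_of_le Real.two_pi_pos.le] at hz
    have hs : 0 ≤ Real.sin (z / 2) :=
      Real.sin_nonneg_of_nonneg_of_le_pi (by linarith [hz.1]) (by linarith [hz.2])
    rw [oneSubCos_coe]
    generalize Real.sin (z / 2) = s at hs
    have h1 : (2 * s ^ 2) ^ 2 + 2 * (2 * s ^ 2) = (2 * s) ^ 2 * (1 + s ^ 2) := by ring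
    rw [h1, Real.sqrt_mul (by positivity), Real.sqrt_sq (by positivity)]
    have h2 : 0 < √(1 + s ^ 2) := Real.sqrt_pos.mpr (by positivity)
    rcases hs.eq_or_lt with h0 | h0
    · rw [← h0]; simp
    · field_simp
      ring
  have hpi : 2 * Real.pi / 2 = Real.pi := by ring
  rw [intervalIntegral.integral_congr hint, intervalIntegral.integral_eq_sub_of_hasDerivAt hderiv]
  · simp only [hpi, zero_div, Real.cos_pi, Real.cos_zero]
    norm_num
  · refine (Continuous.div (by fun_prop) (by fun_prop) fun z => ?_).intervalIntegrable _ _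
    exact (Real.sqrt_pos.mpr (by positivity)).ne'

/-- Inner integral of `a² b² / (2 (a + b))`, by dividing `b²` by `a + b`. -/
theorem integral_sq_mul_sq_div {a : ℝ} (ha : 0 ≤ a) :
    ∫ y : Circ, a ^ 2 * oneSubCos y ^ 2 / (2 * (a + oneSubCos y))
      = Real.pi * (a ^ 2 - a ^ 3) + Real.pi * (a ^ 4 / √(a ^ 2 + 2 * a)) := by
  rcases ha.eq_or_lt with h0 | h0
  · rw [← h0]; simp
  · have h : ∀ y : Circ, a ^ 2 * oneSubCos y ^ 2 / (2 * (a + oneSubCos y))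
        = a ^ 2 / 2 * oneSubCos y - a ^ 3 / 2 + a ^ 4 / 2 * (a + oneSubCos y)⁻¹ := fun y => by
      have : 0 < a + oneSubCos y := by linarith [oneSubCos_nonneg y]
      field_simp
      ring
    have hc := continuous_oneSubCos
    simp only [h]
    rw [integral_add, integral_sub, integral_const_mul, integral_const_mul, integral_oneSubCos,
      integral_inv_add h0]
    · have := integral_circ_one
      rw [integral_const, smul_eq_mul, mul_one] at this
      rw [integral_const, this, smul_eq_mul]
      ring
    · exact integrable_circ (by fun_prop)
    · exact integrable_circ (by fun_prop)
    · exact integrable_circ (by fun_prop)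
    · refine integrable_circ (continuous_const.mul (Continuous.inv₀ (by fun_prop) fun y => ?_))
      linarith [oneSubCos_nonneg y]

/-- The potential `a b / (2 (a + b))` with `a = 1 - cos p₁`, `b = 1 - cos p₂`; it vanishes
where `a + b = 0`. -/
def potential (p : Torus2) : ℝ :=
  oneSubCos p.1 * oneSubCos p.2 / (2 * (oneSubCos p.1 + oneSubCos p.2))

theorem potential_nonneg (p : Torus2) : 0 ≤ potential p := by
  have h1 := oneSubCos_nonneg p.1
  have h2 := oneSubCos_nonneg p.2
  rw [potential]; positivity

theorem potential_le (p : Torus2) : potential p ≤ oneSubCos p.1 := by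
  have h1 := oneSubCos_nonneg p.1
  have h2 := oneSubCos_nonneg p.2
  rw [potential]
  refine div_le_of_le_mul₀ (by positivity) h1 ?_
  nlinarith [mul_nonneg h1 h2, mul_nonneg h1 h1]

theorem continuous_potential : Continuous potential := by
  have hc := continuous_oneSubCos
  rw [continuous_iff_continuousAt]
  intro p
  by_cases h : 2 * (oneSubCos p.1 + oneSubCos p.2) = 0
  · have h1 := oneSubCos_nonneg p.1
    have h2 := oneSubCos_nonneg p.2
    have h3 : oneSubCos p.1 = 0 := by linarith
    have h4 : potential p = 0 := by rw [potential, h3]; simp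
    rw [ContinuousAt, h4]
    have hlim : Filter.Tendsto (fun q : Torus2 => oneSubCos q.1) (nhds p) (nhds 0) := by
      rw [← h3]
      exact (hc.comp continuous_fst).continuousAt
    exact squeeze_zero potential_nonneg potential_le hlim
  · exact ContinuousAt.div (by fun_prop) (by fun_prop) h

theorem integral_product_mul_potential :
    ∫ p : Torus2, oneSubCos p.1 * oneSubCos p.2 * potential p
      = Real.pi * (32 / 3 - 2 * Real.pi) := by
  have hc := continuous_oneSubCos
  have hp := continuous_potential
  have h : ∀ x y : Circ, oneSubCos x * oneSubCos y * potential (x, y)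
      = oneSubCos x ^ 2 * oneSubCos y ^ 2 / (2 * (oneSubCos x + oneSubCos y)) :=
    fun x y => by rw [potential]; ring
  have hint : Integrable fun p : Torus2 => oneSubCos p.1 * oneSubCos p.2 * potential p :=
    integrable_torus (by fun_prop)
  rw [Measure.volume_eq_prod] at hint ⊢
  rw [integral_prod _ hint]
  simp only [h, integral_sq_mul_sq_div (oneSubCos_nonneg _)]
  rw [integral_add, integral_const_mul, integral_const_mul, integral_sub,
    integral_oneSubCos_sq, integral_oneSubCos_cube, integral_quartic_div_sqrt]
  · ring
  · exact integrable_circ (by fun_prop)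
  · exact integrable_circ (by fun_prop)
  · exact integrable_circ (by fun_prop)
  · refine Integrable.of_integral_ne_zero ?_
    rw [integral_const_mul, integral_quartic_div_sqrt]
    positivity

/-- The resolvent of the two-dimensional lattice at the origin diverges at the threshold. -/
theorem exists_lt_integral_resolvent (C : ℝ) :
    ∃ e : ℝ, 0 < e ∧
      C < ∫ p : Torus2, (2 * (e + oneSubCos p.1 + oneSubCos p.2))⁻¹ := by
  have hc := continuous_oneSubCos
  have hpi := Real.pi_pos
  set δ := Real.exp (-(2 / Real.pi * |C| + 1)) with hδ
  have hδ0 : 0 < δ := Real.exp_pos _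
  have hδ1 : δ ≤ 1 := Real.exp_le_one_iff.mpr (by
    have : 0 ≤ 2 / Real.pi * |C| := by positivity
    linarith)
  refine ⟨δ ^ 2 / 2, by positivity, ?_⟩
  set e := δ ^ 2 / 2 with he
  have he0 : 0 < e := by positivity
  have hpos : ∀ p : Torus2, 0 < 2 * (e + oneSubCos p.1 + oneSubCos p.2) := fun p => by
    linarith [oneSubCos_nonneg p.1, oneSubCos_nonneg p.2]
  have hint : Integrable fun p : Torus2 => (2 * (e + oneSubCos p.1 + oneSubCos p.2))⁻¹ :=
    integrable_torus (Continuous.inv₀ (by fun_prop) fun p => (hpos p).ne')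
  rw [Measure.volume_eq_prod] at hint ⊢
  rw [integral_prod _ hint]
  have hinner : ∀ x : Circ, ∫ y : Circ, (2 * (e + oneSubCos x + oneSubCos y))⁻¹
      = Real.pi / √((e + oneSubCos x) ^ 2 + 2 * (e + oneSubCos x)) := fun x => by
    simp only [mul_inv]
    rw [integral_const_mul, integral_inv_add (by linarith [oneSubCos_nonneg x])]
    ring
  simp only [hinner]
  rw [integral_circ]
  have hsq : ∀ z : ℝ, 0 < (e + oneSubCos (z : Circ)) ^ 2 + 2 * (e + oneSubCos (z : Circ)) :=
    fun z => by
      have := oneSubCos_nonneg (z : Circ)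
      positivity
  have hcont : Continuous fun z : ℝ =>
      Real.pi / √((e + oneSubCos (z : Circ)) ^ 2 + 2 * (e + oneSubCos (z : Circ))) := by
    have hq : Continuous fun z : ℝ => oneSubCos (z : Circ) :=
      hc.comp (AddCircle.continuous_mk' _)
    exact Continuous.div (by fun_prop) (by fun_prop) fun z => (Real.sqrt_pos.mpr (hsq z)).ne'
  have hle1 : (1 : ℝ) ≤ 2 * Real.pi := by linarith [Real.pi_gt_three]
  have hsplit := intervalIntegral.integral_add_adjacent_intervals
    (hcont.intervalIntegrable (μ := volume) 0 1)
    (hcont.intervalIntegrable (μ := volume) 1 (2 * Real.pi))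
  have htail := intervalIntegral.integral_nonneg (μ := volume) hle1
    (f := fun z : ℝ => Real.pi / √((e + oneSubCos (z : Circ)) ^ 2 + 2 * (e + oneSubCos (z : Circ))))
    (fun z _ => by positivity)
  have hbound : ∀ z ∈ Set.Icc (0 : ℝ) 1, Real.pi / 2 * (z + δ)⁻¹
      ≤ Real.pi / √((e + oneSubCos (z : Circ)) ^ 2 + 2 * (e + oneSubCos (z : Circ))) := by
    rintro z ⟨hz0, hz1⟩
    have h1 : oneSubCos (z : Circ) ≤ z ^ 2 / 2 := by
      rw [oneSubCos, cosC_coe]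
      linarith [Real.one_sub_sq_div_two_le_cos (x := z)]
    have h0 := oneSubCos_nonneg (z : Circ)
    have h2 : e + oneSubCos (z : Circ) ≤ (z + δ) ^ 2 / 2 := by
      rw [he]; nlinarith [mul_nonneg hz0 hδ0.le]
    have h3 : (z + δ) ^ 2 / 2 ≤ 2 := by nlinarith
    have h4 : √((e + oneSubCos (z : Circ)) ^ 2 + 2 * (e + oneSubCos (z : Circ))) ≤ 2 * (z + δ) := by
      refine Real.sqrt_le_iff.mpr ⟨by positivity, ?_⟩
      nlinarith
    have h5 := Real.sqrt_pos.mpr (hsq z)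
    calc Real.pi / 2 * (z + δ)⁻¹ = Real.pi / (2 * (z + δ)) := by
          have : z + δ ≠ 0 := by positivity
          field_simp
      _ ≤ _ := div_le_div_of_nonneg_left hpi.le h5 h4
  have hlow := intervalIntegral.integral_mono_on (μ := volume) zero_le_one
    (f := fun z : ℝ => Real.pi / 2 * (z + δ)⁻¹) ?_ (hcont.intervalIntegrable 0 1) hbound
  · have hlog : ∫ z in (0 : ℝ)..1, (z + δ)⁻¹ = Real.log ((1 + δ) / δ) := by
      rw [intervalIntegral.integral_comp_add_right (fun z => z⁻¹) δ, zero_add,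
        integral_inv_of_pos hδ0 (by linarith)]
    rw [intervalIntegral.integral_const_mul, hlog, Real.log_div (by positivity) hδ0.ne', hδ,
      Real.log_exp] at hlow
    have h6 : 0 ≤ Real.log (1 + δ) := Real.log_nonneg (by linarith)
    rw [hδ] at h6
    have h7 : Real.pi / 2 * (2 / Real.pi * |C| + 1) = |C| + Real.pi / 2 := by field_simp
    have h8 : Real.pi / 2 * (2 / Real.pi * |C| + 1) ≤
        Real.pi / 2 * (Real.log (1 + Real.exp (-(2 / Real.pi * |C| + 1)))
          - -(2 / Real.pi * |C| + 1)) :=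
      mul_le_mul_of_nonneg_left (by linarith) (by positivity)
    rw [← hsplit]
    linarith [le_abs_self C]
  · refine ContinuousOn.intervalIntegrable (continuousOn_const.mul
      (ContinuousOn.inv₀ (by fun_prop) fun z hz => ?_))
    rw [Set.uIcc_of_le zero_le_one] at hz
    linarith [hz.1]

/-! ### Multiplication operators and lattice values -/

theorem coeFn_mulOp (a : C(Torus2, ℂ)) (f : L2) :
    ∀ᵐ p ∂(volume : Measure Torus2), mulOp a f p = a p * f p :=
  (memLp_mul a f).coeFn_toLp

theorem mulOp_toL2 (a b : C(Torus2, ℂ)) : mulOp a (toL2 b) = toL2 (a * b) := by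
  refine Lp.ext ?_
  filter_upwards [coeFn_mulOp a (toL2 b), coeFn_toL2 b, coeFn_toL2 (a * b)] with p h1 h2 h3
  rw [h1, h2, h3, ContinuousMap.mul_apply]

theorem inner_mulOp (a : C(Torus2, ℂ)) (ha : ∀ p, starRingEnd ℂ (a p) = a p) (f g : L2) :
    inner ℂ (mulOp a f) g = inner ℂ f (mulOp a g) := by
  rw [L2.inner_def, L2.inner_def]
  refine integral_congr_ae ?_
  filter_upwards [coeFn_mulOp a f, coeFn_mulOp a g] with p h1 h2
  rw [h1, h2]
  simp only [RCLike.inner_apply, map_mul, ha]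
  ring

theorem toL2_smul (c : ℂ) (a : C(Torus2, ℂ)) : toL2 (c • a) = c • toL2 a :=
  map_smul (ContinuousMap.toLp 2 volume ℂ) c a

theorem toL2_sub (a b : C(Torus2, ℂ)) : toL2 (a - b) = toL2 a - toL2 b :=
  map_sub (ContinuousMap.toLp 2 volume ℂ) a b

theorem inner_toL2_real {a b : C(Torus2, ℂ)} {x y : Torus2 → ℝ} (ha : ∀ p, a p = x p)
    (hb : ∀ p, b p = y p) :
    inner ℂ (toL2 a) (toL2 b) = ((∫ p : Torus2, x p * y p : ℝ) : ℂ) := by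
  rw [← integral_complex_ofReal, L2.inner_def]
  refine integral_congr_ae ?_
  filter_upwards [coeFn_toL2 a, coeFn_toL2 b] with p h1 h2
  rw [h1, h2, ha, hb, RCLike.inner_apply, Complex.conj_ofReal]
  push_cast
  ring

theorem integral_torus_mul (x y : Circ → ℝ) :
    ∫ p : Torus2, x p.1 * y p.2 = (∫ p, x p) * ∫ p, y p := by
  rw [Measure.volume_eq_prod]
  exact integral_prod_mul x y

theorem fDisp_apply (p : Torus2) :
    fDisp p = ((2 * (oneSubCos p.1 + oneSubCos p.2) : ℝ) : ℂ) := by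
  simp [fDisp, oneSubCos]

theorem conj_fDisp (p : Torus2) : starRingEnd ℂ (fDisp p) = fDisp p := by
  rw [fDisp_apply, Complex.conj_ofReal]

theorem energy_nonneg (f : L2) : 0 ≤ (inner ℂ (mulOp fDisp f) f).re := by
  have h : inner ℂ (mulOp fDisp f) f
      = ((∫ p : Torus2, 2 * (oneSubCos p.1 + oneSubCos p.2) * ‖f p‖ ^ 2 : ℝ) : ℂ) := by
    rw [← integral_complex_ofReal, L2.inner_def]
    refine integral_congr_ae ?_
    filter_upwards [coeFn_mulOp fDisp f] with p h1
    rw [h1, RCLike.inner_apply, map_mul, conj_fDisp, fDisp_apply, mul_left_comm,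
      Complex.mul_conj, Complex.normSq_eq_norm_sq]
    push_cast
    ring
  rw [h, Complex.ofReal_re]
  refine integral_nonneg fun p => ?_
  have h1 := oneSubCos_nonneg p.1
  have h2 := oneSubCos_nonneg p.2
  positivity

/-- Up to normalization, the values of the inverse Fourier transform of `f` at the lattice points
`(0, 0)`, `(1, 0)`, `(2, 0)`, `(1, 1)`. -/
def coords : L2 →ₗ[ℂ] (Fin 4 → ℂ) :=
  LinearMap.pi ![(innerSL ℂ (toL2 fOne)).toLinearMap, (innerSL ℂ (toL2 fCos1)).toLinearMap,
    (innerSL ℂ (toL2 fCosTwo1)).toLinearMap, (innerSL ℂ (toL2 fCosCos)).toLinearMap]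

theorem coords_zero (f : L2) : coords f 0 = inner ℂ (toL2 fOne) f := rfl
theorem coords_one (f : L2) : coords f 1 = inner ℂ (toL2 fCos1) f := rfl
theorem coords_two (f : L2) : coords f 2 = inner ℂ (toL2 fCosTwo1) f := rfl
theorem coords_three (f : L2) : coords f 3 = inner ℂ (toL2 fCosCos) f := rfl

/-- The symmetric function `cos p₁ + cos p₂`. -/
def fCosSum : C(Torus2, ℂ) := fCos1 + fCos2

/-- The potential `(1 - cos p₁) (1 - cos p₂) / ℰ₀(p)` as a complex function. -/
def fPot : C(Torus2, ℂ) :=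
  ⟨fun p => (potential p : ℂ), Complex.continuous_ofReal.comp continuous_potential⟩

theorem fOne_apply (p : Torus2) : fOne p = ((1 : ℝ) : ℂ) := by simp [fOne]
theorem fCos1_apply (p : Torus2) : fCos1 p = ((cosC p.1 : ℝ) : ℂ) := rfl
theorem fCos2_apply (p : Torus2) : fCos2 p = ((cosC p.2 : ℝ) : ℂ) := rfl
theorem fCosTwo1_apply (p : Torus2) : fCosTwo1 p = ((2 * cosC p.1 ^ 2 - 1 : ℝ) : ℂ) := by
  rw [← cosC_two_nsmul]; rfl
theorem fCosTwo2_apply (p : Torus2) : fCosTwo2 p = ((2 * cosC p.2 ^ 2 - 1 : ℝ) : ℂ) := by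
  rw [← cosC_two_nsmul]; rfl
theorem fCosCos_apply (p : Torus2) : fCosCos p = ((cosC p.1 * cosC p.2 : ℝ) : ℂ) := by
  simp [fCosCos]
theorem fCosSum_apply (p : Torus2) : fCosSum p = ((cosC p.1 + cosC p.2 : ℝ) : ℂ) := by
  simp [fCosSum, fCos1, fCos2]
theorem fPot_apply (p : Torus2) : fPot p = ((potential p : ℝ) : ℂ) := rfl

theorem fOne_mem : toL2 fOne ∈ L2ees :=
  toL2_mem_ees _ (fun _ => rfl) (fun _ => rfl) (fun _ => rfl)

theorem fCosSum_mem : toL2 fCosSum ∈ L2ees :=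
  toL2_mem_ees _ (fun p => by simp [fCosSum_apply, cosC_neg])
    (fun p => by simp [fCosSum_apply, add_comm]) (fun p => by simp [fCosSum_apply, cosC_neg])

theorem fPot_mem : toL2 fPot ∈ L2ees :=
  toL2_mem_ees _ (fun p => by simp [fPot_apply, potential, oneSubCos, cosC_neg])
    (fun p => by simp only [fPot_apply, potential]; rw [mul_comm, add_comm])
    (fun p => by simp [fPot_apply, potential, oneSubCos, cosC_neg])

/-! ### Harmonic functions -/

theorem energy_fOne {f : L2} (hf : f ∈ L2ees) :
    inner ℂ (mulOp fDisp (toL2 fOne)) f = 4 * (coords f 0 - coords f 1) := by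
  have h : fDisp * fOne = (4 : ℂ) • fOne - (2 : ℂ) • fCos1 - (2 : ℂ) • fCos2 := by
    ext p
    simp [fDisp, fOne, fCos1, fCos2]
    ring
  rw [mulOp_toL2, h, toL2_sub, toL2_sub, toL2_smul, toL2_smul, toL2_smul, coords_zero, coords_one]
  simp only [inner_sub_left, inner_smul_left, fCos_inner f hf, map_ofNat]
  ring

theorem energy_fCosSum {f : L2} (hf : f ∈ L2ees) :
    inner ℂ (mulOp fDisp (toL2 fCosSum)) f
      = 8 * coords f 1 - 2 * coords f 0 - 2 * coords f 2 - 4 * coords f 3 := by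
  have h : fDisp * fCosSum = (4 : ℂ) • fCos1 + (4 : ℂ) • fCos2 - (2 : ℂ) • fOne
      - fCosTwo1 - fCosTwo2 - (4 : ℂ) • fCosCos := by
    ext p
    simp only [ContinuousMap.mul_apply, ContinuousMap.sub_apply, ContinuousMap.add_apply,
      ContinuousMap.smul_apply, fDisp_apply, fCosSum_apply, fCos1_apply, fCos2_apply, fOne_apply,
      fCosTwo1_apply, fCosTwo2_apply, fCosCos_apply, oneSubCos, smul_eq_mul]
    push_cast
    ring
  rw [mulOp_toL2, h, toL2_sub, toL2_sub, toL2_sub, toL2_sub, ← toL2_add, toL2_smul, toL2_smul,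
    toL2_smul, toL2_smul, coords_zero, coords_one, coords_two, coords_three]
  simp only [inner_sub_left, inner_add_left, inner_smul_left, fCos_inner f hf,
    fCosTwo_inner f hf, map_ofNat]
  ring

theorem fDisp_mul_fPot_apply (p : Torus2) :
    (fDisp * fPot) p = ((oneSubCos p.1 * oneSubCos p.2 : ℝ) : ℂ) := by
  have hreal : 2 * (oneSubCos p.1 + oneSubCos p.2) * potential p
      = oneSubCos p.1 * oneSubCos p.2 := by
    rw [potential]
    by_cases h0 : 2 * (oneSubCos p.1 + oneSubCos p.2) = 0
    · have h1 := oneSubCos_nonneg p.1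
      have h2 := oneSubCos_nonneg p.2
      have h3 : oneSubCos p.1 = 0 := by linarith
      rw [h3]; simp
    · rw [mul_div_cancel₀ _ h0]
  rw [ContinuousMap.mul_apply, fDisp_apply, fPot_apply, ← Complex.ofReal_mul, hreal]

theorem energy_fPot {f : L2} (hf : f ∈ L2ees) :
    inner ℂ (mulOp fDisp (toL2 fPot)) f = coords f 0 - 2 * coords f 1 + coords f 3 := by
  have h : fDisp * fPot = fOne - fCos1 - fCos2 + fCosCos := by
    ext p
    rw [fDisp_mul_fPot_apply]
    simp only [ContinuousMap.sub_apply, ContinuousMap.add_apply,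
      fOne_apply, fCos1_apply, fCos2_apply, fCosCos_apply, oneSubCos]
    push_cast
    ring
  rw [mulOp_toL2, h, ← toL2_add, toL2_sub, toL2_sub, coords_zero, coords_one, coords_three]
  simp only [inner_sub_left, inner_add_left, fCos_inner f hf]
  ring

theorem coords_fOne : coords (toL2 fOne) = ![4 * (Real.pi : ℂ) ^ 2, 0, 0, 0] := by
  have h0 := integral_torus_mul (fun _ => 1) (fun _ => 1)
  have h1 := integral_torus_mul cosC (fun _ => 1)
  have h2 := integral_torus_mul (fun x => 2 * cosC x ^ 2 - 1) (fun _ => 1)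
  have h3 := integral_torus_mul cosC cosC
  have h2' : ∫ x : Circ, (2 * cosC x ^ 2 - 1) = 0 := by
    rw [integral_sub (integrable_circ (by fun_prop)) (integrable_circ (by fun_prop)),
      integral_const_mul, integral_circ_cos_sq, integral_circ_one]
    ring
  ext i
  fin_cases i
  · change coords (toL2 fOne) 0 = 4 * (Real.pi : ℂ) ^ 2
    rw [coords_zero, inner_toL2_real fOne_apply fOne_apply, h0, integral_circ_one]
    push_cast; ring
  · change coords (toL2 fOne) 1 = 0
    rw [coords_one, inner_toL2_real fCos1_apply fOne_apply, h1, integral_circ_cos]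
    simp
  · change coords (toL2 fOne) 2 = 0
    rw [coords_two, inner_toL2_real fCosTwo1_apply fOne_apply, h2, h2']
    simp
  · change coords (toL2 fOne) 3 = 0
    rw [coords_three, inner_toL2_real fCosCos_apply fOne_apply]
    simp only [mul_one]
    rw [h3, integral_circ_cos]
    simp

theorem coords_fCosSum : coords (toL2 fCosSum) = ![0, 2 * (Real.pi : ℂ) ^ 2, 0, 0] := by
  have key : ∀ (x y : C(Circ, ℝ)),
      ∫ p : Torus2, x p.1 * y p.2 * (cosC p.1 + cosC p.2)
        = (∫ p, x p * cosC p) * (∫ p, y p) + (∫ p, x p) * ∫ p, y p * cosC p := by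
    intro x y
    rw [← integral_torus_mul (fun p => x p * cosC p),
      ← integral_torus_mul x (fun p => y p * cosC p),
      ← integral_add (integrable_torus (by fun_prop)) (integrable_torus (by fun_prop))]
    congr 1
    ext p
    ring
  have hs : ∫ x : Circ, cosC x * cosC x = Real.pi := by
    simp only [← pow_two, integral_circ_cos_sq]
  have h2 : ∫ x : Circ, (2 * cosC x ^ 2 - 1) * cosC x = 0 := by
    have : ∀ x : Circ, (2 * cosC x ^ 2 - 1) * cosC x = 2 * cosC x ^ 3 - cosC x := fun x => by ring
    simp only [this]
    rw [integral_sub (integrable_circ (by fun_prop)) (integrable_circ (by fun_prop)),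
      integral_const_mul, integral_circ_cos_cube, integral_circ_cos]
    ring
  have h2' : ∫ x : Circ, (2 * cosC x ^ 2 - 1) = 0 := by
    rw [integral_sub (integrable_circ (by fun_prop)) (integrable_circ (by fun_prop)),
      integral_const_mul, integral_circ_cos_sq, integral_circ_one]
    ring
  have k0 := key 1 1
  have k1 := key cosC 1
  have k2 := key ⟨fun x => 2 * cosC x ^ 2 - 1, by fun_prop⟩ 1
  have k3 := key cosC cosC
  simp only [ContinuousMap.one_apply, ContinuousMap.coe_mk, one_mul, mul_one, integral_circ_cos,
    integral_circ_one, hs, h2, h2', zero_mul, mul_zero, add_zero] at k0 k1 k2 k3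
  ext i
  fin_cases i
  · change coords (toL2 fCosSum) 0 = 0
    rw [coords_zero, inner_toL2_real fOne_apply fCosSum_apply]
    simp only [one_mul]
    rw [k0]; simp
  · change coords (toL2 fCosSum) 1 = 2 * (Real.pi : ℂ) ^ 2
    rw [coords_one, inner_toL2_real fCos1_apply fCosSum_apply, k1]
    push_cast; ring
  · change coords (toL2 fCosSum) 2 = 0
    rw [coords_two, inner_toL2_real fCosTwo1_apply fCosSum_apply, k2]
    simp
  · change coords (toL2 fCosSum) 3 = 0
    rw [coords_three, inner_toL2_real fCosCos_apply fCosSum_apply, k3]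
    simp

/-- The difference of the values of the potential at `(2, 0)` and `(1, 1)`. -/
def potJump : ℝ := -2 * Real.pi * (16 - 5 * Real.pi)

theorem coords_fPot :
    coords (toL2 fPot) 0 - coords (toL2 fPot) 1 = (Real.pi : ℂ) ^ 2 ∧
    coords (toL2 fPot) 2 - coords (toL2 fPot) 1
      = 7 * (Real.pi : ℂ) ^ 2 - 64 / 3 * Real.pi ∧
    coords (toL2 fPot) 2 - coords (toL2 fPot) 3 = (potJump : ℂ) := by
  -- Symmetry of the energy pairing computes the sources of `fOne` and `fCosSum` on the potential.
  have hsymm : ∀ f g : L2, inner ℂ (mulOp fDisp f) g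
      = starRingEnd ℂ (inner ℂ (mulOp fDisp g) f) := fun f g => by
    rw [inner_mulOp fDisp conj_fDisp, inner_conj_symm]
  have e0 := energy_fOne fPot_mem
  have e1 := energy_fCosSum fPot_mem
  have e2 := energy_fPot fPot_mem
  rw [hsymm, energy_fPot fOne_mem, coords_fOne] at e0
  rw [hsymm, energy_fPot fCosSum_mem, coords_fCosSum] at e1
  have hJ : inner ℂ (mulOp fDisp (toL2 fPot)) (toL2 fPot)
      = ((Real.pi * (32 / 3 - 2 * Real.pi) : ℝ) : ℂ) := by
    rw [mulOp_toL2, inner_toL2_real fDisp_mul_fPot_apply fPot_apply,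
      integral_product_mul_potential]
  rw [hJ] at e2
  simp [Complex.conj_ofNat] at e0 e1 e2
  rw [potJump]
  push_cast
  refine ⟨?_, ?_, ?_⟩
  · linear_combination -e0
  · linear_combination e1 / 2 - e0 + 2 * e2
  · linear_combination e1 / 2 - 2 * e0 + 3 * e2

/-! ### The reduced Dirichlet form and its minimizers -/

theorem potJump_ne_zero : (potJump : ℂ) ≠ 0 := by
  have := sixteen_sub_pos
  have h : potJump < 0 := by
    rw [potJump]
    nlinarith [Real.pi_pos, mul_pos Real.pi_pos this]
  exact_mod_cast h.ne

/-- The coefficients of `harm v` with respect to `1`, `cos p₁ + cos p₂` and the potential. -/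
def harmCoeff (v : Fin 4 → ℂ) : ℂ × ℂ × ℂ :=
  let c := (v 2 - v 3) / potJump
  let b := (c * (7 * (Real.pi : ℂ) ^ 2 - 64 / 3 * Real.pi) - (v 2 - v 1)) / (2 * (Real.pi : ℂ) ^ 2)
  (((v 0 - v 1) + 2 * (Real.pi : ℂ) ^ 2 * b - c * (Real.pi : ℂ) ^ 2) / (4 * (Real.pi : ℂ) ^ 2),
    b, c)

/-- The minimizer of the Dirichlet energy among functions whose four values have the same
differences as `v`. -/
def harm : (Fin 4 → ℂ) →ₗ[ℂ] L2 where
  toFun v := (harmCoeff v).1 • toL2 fOne + (harmCoeff v).2.1 • toL2 fCosSum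
    + (harmCoeff v).2.2 • toL2 fPot
  map_add' v w := by
    simp only [harmCoeff, Pi.add_apply]
    module
  map_smul' r v := by
    simp only [harmCoeff, Pi.smul_apply, smul_eq_mul, RingHom.id_apply]
    module

theorem harm_apply (v : Fin 4 → ℂ) : harm v = (harmCoeff v).1 • toL2 fOne
    + (harmCoeff v).2.1 • toL2 fCosSum + (harmCoeff v).2.2 • toL2 fPot := rfl

theorem harm_mem (v : Fin 4 → ℂ) : harm v ∈ L2ees :=
  L2ees.add_mem (L2ees.add_mem (L2ees.smul_mem _ fOne_mem) (L2ees.smul_mem _ fCosSum_mem))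
    (L2ees.smul_mem _ fPot_mem)

/-- The difference between `v` and the values of `harm v`, a constant. -/
def offset : (Fin 4 → ℂ) →ₗ[ℂ] ℂ where
  toFun v := v 1 - coords (harm v) 1
  map_add' v w := by simp only [map_add, Pi.add_apply]; ring
  map_smul' r v := by simp only [map_smul, Pi.smul_apply, smul_eq_mul, RingHom.id_apply]; ring

theorem offset_apply (v : Fin 4 → ℂ) : offset v = v 1 - coords (harm v) 1 := rfl

theorem coords_harm (v : Fin 4 → ℂ) (i : Fin 4) : coords (harm v) i = v i - offset v := by
  obtain ⟨e0, e2, e3⟩ := coords_fPot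
  have hpi : (Real.pi : ℂ) ≠ 0 := by exact_mod_cast Real.pi_ne_zero
  have hc : (harmCoeff v).2.2 * potJump = v 2 - v 3 := div_mul_cancel₀ _ potJump_ne_zero
  have hb : (harmCoeff v).2.1 * (2 * (Real.pi : ℂ) ^ 2)
      = (harmCoeff v).2.2 * (7 * (Real.pi : ℂ) ^ 2 - 64 / 3 * Real.pi) - (v 2 - v 1) :=
    div_mul_cancel₀ _ (by simp [hpi])
  have ha : (harmCoeff v).1 * (4 * (Real.pi : ℂ) ^ 2)
      = (v 0 - v 1) + 2 * (Real.pi : ℂ) ^ 2 * (harmCoeff v).2.1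
        - (harmCoeff v).2.2 * (Real.pi : ℂ) ^ 2 :=
    div_mul_cancel₀ _ (by simp [hpi])
  have h : ∀ j, coords (harm v) j = (harmCoeff v).1 * coords (toL2 fOne) j
      + (harmCoeff v).2.1 * coords (toL2 fCosSum) j
      + (harmCoeff v).2.2 * coords (toL2 fPot) j := fun j => by
    rw [harm_apply]; simp
  rw [offset_apply, h, h, coords_fOne, coords_fCosSum]
  fin_cases i
  · simp
    linear_combination ha + (harmCoeff v).2.2 * e0
  · simp
  · simp
    linear_combination (harmCoeff v).2.2 * e2 - hb
  · simp
    linear_combination (harmCoeff v).2.2 * e2 - hb - (harmCoeff v).2.2 * e3 - hc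

/-- The reduced Dirichlet form as a sesquilinear form. -/
def traceSesq (v w : Fin 4 → ℂ) : ℂ :=
  4 * (starRingEnd ℂ (v 0 - v 1) * (w 0 - w 1)) + 4 * (starRingEnd ℂ (v 1 - v 2) * (w 1 - w 2))
    + 8 * (starRingEnd ℂ (v 1 - v 3) * (w 1 - w 3))
    + kap * (starRingEnd ℂ (v 2 - v 3) * (w 2 - w 3))

theorem kap_mul_potJump : kap * potJump = -4 * (7 * Real.pi ^ 2 - 64 / 3 * Real.pi) := by
  rw [potJump]
  linear_combination -2 / 3 * Real.pi * kap_mul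

/-- The energy pairing with `harm v` only sees the four values. -/
theorem energy_harm (v : Fin 4 → ℂ) {f : L2} (hf : f ∈ L2ees) :
    4 * (Real.pi : ℂ) ^ 2 * inner ℂ (mulOp fDisp (harm v)) f = traceSesq v (coords f) := by
  have hk : (kap : ℂ) * potJump = -4 * (7 * (Real.pi : ℂ) ^ 2 - 64 / 3 * Real.pi) := by
    have h := congrArg Complex.ofReal kap_mul_potJump
    push_cast at h
    exact h
  have hpi : (Real.pi : ℂ) ≠ 0 := by exact_mod_cast Real.pi_ne_zero
  have hj := potJump_ne_zero
  rw [harm_apply]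
  simp only [map_add, map_smul, inner_add_left, inner_smul_left, energy_fOne hf,
    energy_fCosSum hf, energy_fPot hf, traceSesq, harmCoeff]
  simp only [map_sub, map_add, map_mul, map_div₀, map_pow, Complex.conj_ofReal,
    Complex.conj_ofNat]
  have hk' : (kap : ℂ) = -4 * (7 * (Real.pi : ℂ) ^ 2 - 64 / 3 * Real.pi) / potJump := by
    rw [← hk]; field_simp
  have hp' : (potJump : ℂ) = -2 * Real.pi * (16 - 5 * Real.pi) := by rw [potJump]; push_cast; ring
  rw [hk']
  field_simp
  rw [hp']
  ring

theorem traceSesq_self (v : Fin 4 → ℂ) :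
    (traceSesq v v).re = traceForm (fun i => (v i).re) + traceForm (fun i => (v i).im) := by
  simp [traceSesq, traceForm]
  ring

theorem traceSesq_sub_const (v w : Fin 4 → ℂ) (c : ℂ) :
    traceSesq v (fun i => w i - c) = traceSesq v w := by
  simp [traceSesq]

theorem coords_harm_eq (v : Fin 4 → ℂ) : coords (harm v) = fun i => v i - offset v :=
  funext (coords_harm v)

theorem energy_conj (f g : L2) :
    (inner ℂ (mulOp fDisp f) g).re = (inner ℂ (mulOp fDisp g) f).re := by
  rw [inner_mulOp fDisp conj_fDisp, ← inner_conj_symm, Complex.conj_re]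

/-- Pythagoras: the energy of `f` splits into the reduced form of its values and the energy of
the remainder. -/
theorem energy_eq {f : L2} (hf : f ∈ L2ees) :
    4 * Real.pi ^ 2 * (inner ℂ (mulOp fDisp f) f).re = (traceSesq (coords f) (coords f)).re
      + 4 * Real.pi ^ 2 * (inner ℂ (mulOp fDisp (f - harm (coords f)))
        (f - harm (coords f))).re := by
  set g := harm (coords f) with hg
  have h1 := energy_harm (coords f) hf
  have h2 := energy_harm (coords f) (harm_mem (coords f))
  rw [coords_harm_eq, traceSesq_sub_const] at h2
  rw [← hg] at h1 h2
  have hre : ∀ z : ℂ, (4 * (Real.pi : ℂ) ^ 2 * z).re = 4 * Real.pi ^ 2 * z.re := fun z => by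
    have : (4 * (Real.pi : ℂ) ^ 2) = ((4 * Real.pi ^ 2 : ℝ) : ℂ) := by push_cast; ring
    rw [this, Complex.re_ofReal_mul]
  have h1' := congrArg Complex.re h1
  have h2' := congrArg Complex.re h2
  rw [hre] at h1' h2'
  have h3 := energy_conj f g
  simp only [map_sub, inner_sub_left, inner_sub_right, Complex.sub_re]
  rw [h3]
  linarith

theorem traceForm_le_energy {f : L2} (hf : f ∈ L2ees) :
    (traceSesq (coords f) (coords f)).re ≤ 4 * Real.pi ^ 2 * (inner ℂ (mulOp fDisp f) f).re := by
  rw [energy_eq hf]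
  have := energy_nonneg (f - harm (coords f))
  have : 0 ≤ 4 * Real.pi ^ 2 * (inner ℂ (mulOp fDisp (f - harm (coords f)))
      (f - harm (coords f))).re := by positivity
  linarith

/-! ### Approximate constants: recurrence of the square lattice -/

theorem resolvent_denom_pos {e : ℝ} (he : 0 < e) (p : Torus2) :
    0 < 2 * (e + oneSubCos p.1 + oneSubCos p.2) := by
  linarith [oneSubCos_nonneg p.1, oneSubCos_nonneg p.2]

/-- The function `(ℰ₀(p) + 2 e)⁻¹`. -/
def fRes {e : ℝ} (he : 0 < e) : C(Torus2, ℂ) :=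
  ⟨fun p => (((2 * (e + oneSubCos p.1 + oneSubCos p.2))⁻¹ : ℝ) : ℂ),
    Complex.continuous_ofReal.comp (Continuous.inv₀
      (by have := continuous_oneSubCos; fun_prop) fun p => (resolvent_denom_pos he p).ne')⟩

theorem fRes_apply {e : ℝ} (he : 0 < e) (p : Torus2) :
    fRes he p = (((2 * (e + oneSubCos p.1 + oneSubCos p.2))⁻¹ : ℝ) : ℂ) := rfl

theorem fRes_mem {e : ℝ} (he : 0 < e) : toL2 (fRes he) ∈ L2ees :=
  toL2_mem_ees _ (fun p => by simp [fRes_apply, oneSubCos, cosC_neg])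
    (fun p => by simp only [fRes_apply]; congr 3; ring)
    (fun p => by simp [fRes_apply, oneSubCos, cosC_neg])

theorem continuous_fRes_real {e : ℝ} (he : 0 < e) :
    Continuous fun p : Torus2 => (2 * (e + oneSubCos p.1 + oneSubCos p.2))⁻¹ :=
  Continuous.inv₀ (by have := continuous_oneSubCos; fun_prop)
    fun p => (resolvent_denom_pos he p).ne'

theorem fDisp_mul_fRes_apply {e : ℝ} (he : 0 < e) (p : Torus2) :
    (fDisp * fRes he) p = ((2 * (oneSubCos p.1 + oneSubCos p.2)
      * (2 * (e + oneSubCos p.1 + oneSubCos p.2))⁻¹ : ℝ) : ℂ) := by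
  rw [ContinuousMap.mul_apply, fDisp_apply, fRes_apply, ← Complex.ofReal_mul]

theorem disp_mul_resolvent_le {e : ℝ} (he : 0 < e) (p : Torus2) :
    2 * (oneSubCos p.1 + oneSubCos p.2) * (2 * (e + oneSubCos p.1 + oneSubCos p.2))⁻¹ ≤ 1 := by
  rw [mul_inv_le_iff₀ (resolvent_denom_pos he p)]
  linarith

theorem disp_mul_resolvent_nonneg {e : ℝ} (he : 0 < e) (p : Torus2) :
    0 ≤ 2 * (oneSubCos p.1 + oneSubCos p.2)
      * (2 * (e + oneSubCos p.1 + oneSubCos p.2))⁻¹ := by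
  have h1 := oneSubCos_nonneg p.1
  have h2 := oneSubCos_nonneg p.2
  positivity

/-- The value at the origin is not controlled by the energy. -/
theorem exists_energy_lt (C : ℝ) :
    ∃ f ∈ L2ees, C * (inner ℂ (mulOp fDisp f) f).re < ‖coords f 0‖ ^ 2 := by
  obtain ⟨e, he, hL⟩ := exists_lt_integral_resolvent |C|
  refine ⟨toL2 (fRes he), fRes_mem he, ?_⟩
  have hc := continuous_oneSubCos
  have hr := continuous_fRes_real he
  set L := ∫ p : Torus2, (2 * (e + oneSubCos p.1 + oneSubCos p.2))⁻¹ with hLdef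
  have h0 : coords (toL2 (fRes he)) 0 = (L : ℂ) := by
    rw [coords_zero, inner_toL2_real fOne_apply (fRes_apply he)]
    simp only [one_mul, hLdef]
  have hen : (inner ℂ (mulOp fDisp (toL2 (fRes he))) (toL2 (fRes he))).re ≤ L := by
    rw [mulOp_toL2, inner_toL2_real (fDisp_mul_fRes_apply he) (fRes_apply he), Complex.ofReal_re]
    refine integral_mono (integrable_torus (by fun_prop)) (integrable_torus hr) fun p => ?_
    exact mul_le_of_le_one_left (inv_nonneg.mpr (resolvent_denom_pos he p).le)
      (disp_mul_resolvent_le he p)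
  have hen0 := energy_nonneg (toL2 (fRes he))
  rw [h0, Complex.norm_real, Real.norm_eq_abs, sq_abs]
  have := abs_nonneg C
  nlinarith [le_abs_self C, mul_le_mul_of_nonneg_right (le_abs_self C) hen0]

/-- The free operator is not bounded below on `L^{2,ees}`. -/
theorem exists_mulOp_lt (C : ℝ) : ∃ f ∈ L2ees, C * ‖mulOp fDisp f‖ < ‖f‖ := by
  have hpi := Real.pi_pos
  obtain ⟨e, he, hL⟩ := exists_lt_integral_resolvent (|C| * (2 * Real.pi) * (2 * Real.pi))
  refine ⟨toL2 (fRes he), fRes_mem he, ?_⟩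
  have hc := continuous_oneSubCos
  have hr := continuous_fRes_real he
  set L := ∫ p : Torus2, (2 * (e + oneSubCos p.1 + oneSubCos p.2))⁻¹ with hLdef
  have hone : ∫ _ : Torus2, (1 : ℝ) = (2 * Real.pi) ^ 2 := by
    have := integral_torus_mul (fun _ => 1) (fun _ => 1)
    rw [integral_circ_one, mul_one] at this
    rw [this, sq]
  have hnorm : ∀ (a : C(Torus2, ℂ)) (x : Torus2 → ℝ), (∀ p, a p = x p) →
      ‖toL2 a‖ ^ 2 = ∫ p, x p * x p := fun a x h => by
    have := congrArg Complex.re (inner_toL2_real h h)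
    rw [Complex.ofReal_re] at this
    rw [← this]
    exact (inner_self_eq_norm_sq (𝕜 := ℂ) _).symm
  have h1 : ‖toL2 fOne‖ ≤ 2 * Real.pi := by
    refine abs_le_of_sq_le_sq' ?_ (by positivity) |>.2
    rw [hnorm _ _ fOne_apply, one_mul, hone]
  have h2 : ‖mulOp fDisp (toL2 (fRes he))‖ ≤ 2 * Real.pi := by
    refine abs_le_of_sq_le_sq' ?_ (by positivity) |>.2
    rw [mulOp_toL2, hnorm _ _ (fDisp_mul_fRes_apply he), ← hone]
    refine integral_mono (integrable_torus (by fun_prop)) (integrable_torus continuous_const)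
      fun p => ?_
    exact mul_le_one₀ (disp_mul_resolvent_le he p) (disp_mul_resolvent_nonneg he p)
      (disp_mul_resolvent_le he p)
  have h3 : L ≤ 2 * Real.pi * ‖toL2 (fRes he)‖ := by
    have h := norm_inner_le_norm (𝕜 := ℂ) (toL2 fOne) (toL2 (fRes he))
    rw [inner_toL2_real fOne_apply (fRes_apply he), Complex.norm_real] at h
    simp only [one_mul] at h
    exact (le_abs_self L).trans (h.trans (mul_le_mul_of_nonneg_right h1 (norm_nonneg _)))
  have h4 : C * ‖mulOp fDisp (toL2 (fRes he))‖ ≤ |C| * (2 * Real.pi) :=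
    (mul_le_mul_of_nonneg_right (le_abs_self C) (norm_nonneg _)).trans
      (mul_le_mul_of_nonneg_left h2 (abs_nonneg C))
  have h5 : |C| * (2 * Real.pi) < ‖toL2 (fRes he)‖ := by
    refine lt_of_mul_lt_mul_left ?_ (by positivity : 0 ≤ 2 * Real.pi)
    linarith
  linarith

theorem exists_bound {ι : Type*} [Fintype ι] (l : (ι → ℂ) →ₗ[ℂ] ℂ) :
    ∃ C : ℝ, 0 < C ∧ ∀ v, ‖l v‖ ^ 2 ≤ C * ‖v‖ ^ 2 := by
  refine ⟨‖l.toContinuousLinearMap‖ ^ 2 + 1, by positivity, fun v => ?_⟩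
  have h := l.toContinuousLinearMap.le_opNorm v
  have h2 : ‖l v‖ ^ 2 ≤ (‖l.toContinuousLinearMap‖ * ‖v‖) ^ 2 :=
    pow_le_pow_left₀ (norm_nonneg _) h 2
  nlinarith [sq_nonneg ‖v‖]

theorem traceSesq_self_norm (v : Fin 4 → ℂ) :
    (traceSesq v v).re = 4 * ‖v 0 - v 1‖ ^ 2 + 4 * ‖v 1 - v 2‖ ^ 2 + 8 * ‖v 1 - v 3‖ ^ 2
      + kap * ‖v 2 - v 3‖ ^ 2 := by
  simp only [← Complex.normSq_eq_norm_sq, Complex.normSq_apply]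
  simp [traceSesq]
  ring

/-- There are functions with all four values equal to `1` and arbitrarily small energy. -/
theorem exists_approx_const {η : ℝ} (hη : 0 < η) :
    ∃ h ∈ L2ees, (∀ i, coords h i = 1) ∧
      4 * Real.pi ^ 2 * (inner ℂ (mulOp fDisp h) h).re ≤ η := by
  have hpi := Real.pi_pos
  obtain ⟨M, hM, hbound⟩ := exists_bound ((LinearMap.proj 0 ∘ₗ coords) ∘ₗ harm)
  have hb : ∀ v, ‖coords (harm v) 0‖ ^ 2 ≤ M * (traceSesq v v).re := by
    intro v
    have hconst : harm v = harm (fun i => v i - v 1) := by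
      simp only [harm_apply, harmCoeff, sub_sub_sub_cancel_right]
    have h1 : ‖coords (harm v) 0‖ ^ 2 ≤ M * ‖fun i => v i - v 1‖ ^ 2 := by
      rw [hconst]; exact hbound _
    refine h1.trans (mul_le_mul_of_nonneg_left ?_ hM.le)
    have hk := kap_pos
    rw [traceSesq_self_norm]
    obtain ⟨i, -, hi⟩ := Finset.exists_mem_eq_sup' (s := (Finset.univ : Finset (Fin 4)))
      Finset.univ_nonempty (fun i => ‖v i - v 1‖)
    have hle : ‖fun i => v i - v 1‖ ≤ ‖v i - v 1‖ := by
      refine (pi_norm_le_iff_of_nonneg (norm_nonneg _)).mpr fun j => ?_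
      rw [← hi]
      exact Finset.le_sup' (fun i => ‖v i - v 1‖) (Finset.mem_univ j)
    refine (pow_le_pow_left₀ (norm_nonneg _) hle 2).trans ?_
    have p0 := sq_nonneg ‖v 0 - v 1‖
    have p1 := sq_nonneg ‖v 1 - v 2‖
    have p2 := sq_nonneg ‖v 1 - v 3‖
    have p3 := mul_nonneg hk.le (sq_nonneg ‖v 2 - v 3‖)
    have q2 := norm_sub_rev (v 2) (v 1)
    have q3 := norm_sub_rev (v 3) (v 1)
    fin_cases i
    · change ‖v 0 - v 1‖ ^ 2 ≤ _; linarith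
    · change ‖v 1 - v 1‖ ^ 2 ≤ _; rw [sub_self, norm_zero]; linarith
    · change ‖v 2 - v 1‖ ^ 2 ≤ _; rw [q2]; linarith
    · change ‖v 3 - v 1‖ ^ 2 ≤ _; rw [q3]; linarith
  obtain ⟨f, hf, hlt⟩ := exists_energy_lt (4 * Real.pi ^ 2 * (2 * M + 2 / η))
  set g := f - harm (coords f) with hg
  have hgmem : g ∈ L2ees := L2ees.sub_mem hf (harm_mem _)
  set s := offset (coords f) with hs
  have hgc : ∀ i, coords g i = s := fun i => by
    rw [hg, map_sub, Pi.sub_apply, coords_harm]; ring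
  have hE := energy_eq hf
  rw [← hg] at hE
  have hT := traceForm_le_energy hf
  have hT0 : 0 ≤ (traceSesq (coords f) (coords f)).re := by
    have := kap_pos
    rw [traceSesq_self_norm]; positivity
  have h0 := hb (coords f)
  have hsum : ‖coords f 0‖ ^ 2 ≤ 2 * ‖s‖ ^ 2 + 2 * ‖coords (harm (coords f)) 0‖ ^ 2 := by
    have h1 : coords f 0 = s + coords (harm (coords f)) 0 := by
      rw [coords_harm]; ring
    have h2 := norm_add_le s (coords (harm (coords f)) 0)
    rw [← h1] at h2
    nlinarith [norm_nonneg (coords f 0), sq_nonneg (‖s‖ - ‖coords (harm (coords f)) 0‖)]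
  have hen := energy_nonneg f
  have hkey : 4 * Real.pi ^ 2 * (inner ℂ (mulOp fDisp f) f).re < η * ‖s‖ ^ 2 := by
    have h1 := mul_le_mul_of_nonneg_left hT hM.le
    have h2 : 4 * Real.pi ^ 2 * (inner ℂ (mulOp fDisp f) f).re / η < ‖s‖ ^ 2 := by
      have h3 : 4 * Real.pi ^ 2 * (2 * M + 2 / η) * (inner ℂ (mulOp fDisp f) f).re
          = 2 * (M * (4 * Real.pi ^ 2 * (inner ℂ (mulOp fDisp f) f).re))
            + 2 * (4 * Real.pi ^ 2 * (inner ℂ (mulOp fDisp f) f).re / η) := by ring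
      rw [h3] at hlt
      linarith
    rw [div_lt_iff₀ hη] at h2
    linarith
  have hs0 : s ≠ 0 := by
    intro h
    rw [h, norm_zero] at hkey
    have : 0 ≤ 4 * Real.pi ^ 2 * (inner ℂ (mulOp fDisp f) f).re := by positivity
    linarith
  refine ⟨s⁻¹ • g, L2ees.smul_mem _ hgmem, fun i => ?_, ?_⟩
  · rw [map_smul, Pi.smul_apply, hgc, smul_eq_mul, inv_mul_cancel₀ hs0]
  · have hsn : 0 < ‖s‖ ^ 2 := by
      have := norm_pos_iff.mpr hs0
      positivity
    have h1 : inner ℂ (mulOp fDisp (s⁻¹ • g)) (s⁻¹ • g)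
        = (((‖s‖ ^ 2)⁻¹ : ℝ) : ℂ) * inner ℂ (mulOp fDisp g) g := by
      rw [map_smul, inner_smul_left, inner_smul_right, ← mul_assoc, mul_comm (starRingEnd ℂ s⁻¹),
        Complex.mul_conj, Complex.normSq_eq_norm_sq, norm_inv, inv_pow]
    rw [h1, Complex.re_ofReal_mul, mul_left_comm, inv_mul_le_iff₀ hsn]
    linarith

/-! ### The number of eigenvalues below the essential spectrum -/

theorem isClosed_invariantL2 (σ : Torus2 → Torus2) (hσ : MeasurePreserving σ volume volume) :
    IsClosed (invariantL2 σ hσ : Set L2) := by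
  have h : (invariantL2 σ hσ : Set L2)
      = {f | Lp.compMeasurePreservingₗᵢ ℂ σ hσ f = f} := by
    ext f
    have h1 : ∀ᵐ p ∂(volume : Measure Torus2),
        Lp.compMeasurePreservingₗᵢ ℂ σ hσ f p = f (σ p) := Lp.coeFn_compMeasurePreserving f hσ
    constructor
    · intro hf
      refine Lp.ext ?_
      have hf' : ∀ᵐ p ∂(volume : Measure Torus2), f (σ p) = f p := hf
      filter_upwards [h1, hf'] with p h2 h3
      rw [h2, h3]
    · intro hf
      have hf' : Lp.compMeasurePreservingₗᵢ ℂ σ hσ f = f := hf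
      rw [hf'] at h1
      change ∀ᵐ p ∂(volume : Measure Torus2), f (σ p) = f p
      filter_upwards [h1] with p h2
      exact h2.symm
  rw [h]
  exact isClosed_eq (LinearIsometry.continuous _) continuous_id

instance completeSpace_L2ees : CompleteSpace L2ees := by
  have h : IsClosed (L2ees : Set L2) :=
    ((isClosed_invariantL2 _ mp_neg).inter (isClosed_invariantL2 _ mp_swap)).inter
      (isClosed_invariantL2 _ mp_refl)
  exact h.completeSpace_coe

theorem mulOp_fDisp_mem (f : L2) (hf : f ∈ L2ees) : mulOp fDisp f ∈ L2ees :=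
  ⟨⟨mulOp_mem _ mp_neg _ (fun p => by simp [fDisp, cosC_neg]) f hf.1.1,
    mulOp_mem _ mp_swap _ (fun p => by simp [fDisp, add_comm]) f hf.1.2⟩,
    mulOp_mem _ mp_refl _ (fun p => by simp [fDisp, cosC_neg]) f hf.2⟩

theorem interaction_mem (γ lam μ : ℝ) (f : L2) (hf : f ∈ L2ees) :
    interaction γ lam μ f ∈ L2ees := by
  have h := L2ees.sub_mem (hamiltonian_mem γ lam μ f hf) (mulOp_fDisp_mem f hf)
  rwa [hamiltonian, _root_.add_apply, add_sub_cancel_left] at h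

/-- The free operator on `L^{2,ees}`. -/
def dispEES : L2ees →L[ℂ] L2ees := (mulOp fDisp).restrict mulOp_fDisp_mem

/-- The interaction on `L^{2,ees}`. -/
def interactionEES (γ lam μ : ℝ) : L2ees →L[ℂ] L2ees :=
  (interaction γ lam μ).restrict (interaction_mem γ lam μ)

theorem hamiltonianEES_eq (γ lam μ : ℝ) :
    hamiltonianEES γ lam μ = dispEES + interactionEES γ lam μ := by
  ext f
  rfl

theorem dispEES_isPositive : dispEES.IsPositive :=
  ⟨fun f g => inner_mulOp fDisp conj_fDisp f g, fun f => energy_nonneg f⟩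

theorem dispEES_injective : Function.Injective dispEES := by
  rw [injective_iff_map_eq_zero]
  intro f hf
  have h0 : mulOp fDisp (f : L2) = 0 := congrArg Subtype.val hf
  have hz : ∀ᵐ p ∂(volume : Measure Torus2), p.1 ≠ 0 := by
    have : (volume : Measure Torus2) {p : Torus2 | ¬ p.1 ≠ 0} = 0 := by
      have hset : {p : Torus2 | ¬ p.1 ≠ 0} = ({0} : Set Circ) ×ˢ Set.univ := by
        ext p; simp
      have h0 : (volume : Measure Circ) {0} = 0 := by
        rw [← Metric.closedBall_zero, AddCircle.volume_closedBall, mul_zero,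
          min_eq_right Real.two_pi_pos.le, ENNReal.ofReal_zero]
      rw [hset, Measure.volume_eq_prod, Measure.prod_prod, h0, zero_mul]
    exact this
  refine Subtype.ext (Lp.ext ?_)
  have h1 := coeFn_mulOp fDisp (f : L2)
  rw [h0] at h1
  filter_upwards [h1, hz, Lp.coeFn_zero ℂ 2 (volume : Measure Torus2)] with p h2 h3 h4
  change (f : L2) p = (0 : L2) p
  rw [h4] at h2 ⊢
  have h5 : 0 < oneSubCos p.1 := by
    refine lt_of_le_of_ne (oneSubCos_nonneg _) fun h => h3 (eq_zero_of_cosC_eq_one ?_)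
    rw [oneSubCos] at h; linarith
  have h6 := oneSubCos_nonneg p.2
  have h7 : fDisp p ≠ 0 := by
    rw [fDisp_apply, Complex.ofReal_ne_zero]
    linarith
  have h8 : fDisp p * (f : L2) p = 0 := h2.symm
  exact (mul_eq_zero.mp h8).resolve_left h7

theorem inner_proj (a : C(Torus2, ℂ)) (f g : L2) :
    inner ℂ (proj a f) g = inner ℂ f (proj a g) := by
  rw [proj_apply, proj_apply, inner_smul_left, inner_smul_right, inner_conj_symm, mul_comm]

theorem inner_interaction_symm (γ lam μ : ℝ) (f g : L2) :
    inner ℂ (interaction γ lam μ f) g = inner ℂ f (interaction γ lam μ g) := by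
  simp only [interaction, _root_.add_apply, _root_.smul_apply, inner_add_left, inner_add_right,
    inner_smul_left, inner_smul_right, inner_proj, Complex.conj_ofReal]

theorem hasFiniteRange_proj (a : C(Torus2, ℂ)) : (proj a).toLinearMap.HasFiniteRange := by
  have : (proj a).toLinearMap = (LinearMap.toSpanSingleton ℂ L2 (toL2 a))
      ∘ₗ (innerSL ℂ (toL2 a)).toLinearMap := by
    ext f; rfl
  rw [this]
  exact LinearMap.HasFiniteRange.comp_right (LinearMap.HasFiniteRange.of_finite_dom) _

theorem hasFiniteRange_interaction (γ lam μ : ℝ) :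
    (interaction γ lam μ).toLinearMap.HasFiniteRange := by
  have h := hasFiniteRange_proj
  exact (((((h _).smul _).add (((h _).add (h _)).smul _)).add (((h _).add (h _)).smul _)).add
    ((h _).smul _)).add ((h _).smul _)

theorem hasFiniteRange_interactionEES (γ lam μ : ℝ) :
    (interactionEES γ lam μ).toLinearMap.HasFiniteRange := by
  have h1 := ((hasFiniteRange_interaction γ lam μ).comp_right L2ees.subtype).cofg_ker
  rw [← LinearMap.ker_coFG_iff_hasFiniteRange]
  have h2 : (interactionEES γ lam μ).toLinearMap.ker
      = ((interaction γ lam μ).toLinearMap ∘ₗ L2ees.subtype).ker := by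
    ext f
    rw [LinearMap.mem_ker, LinearMap.mem_ker, ← Submodule.coe_eq_zero]
    rfl
  rw [h2]
  exact h1

theorem hamiltonianEES_isSelfAdjoint (γ lam μ : ℝ) :
    IsSelfAdjoint (dispEES + interactionEES γ lam μ) := by
  rw [ContinuousLinearMap.isSelfAdjoint_iff_isSymmetric]
  intro f g
  change inner ℂ (mulOp fDisp (f : L2) + interaction γ lam μ f) (g : L2)
    = inner ℂ (f : L2) (mulOp fDisp (g : L2) + interaction γ lam μ g)
  rw [inner_add_left, inner_add_right, inner_mulOp fDisp conj_fDisp, inner_interaction_symm]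

/-- The interaction is a multiplication operator on the lattice. -/
theorem inner_interaction (γ lam μ : ℝ) {f : L2} (hf : f ∈ L2ees) :
    4 * Real.pi ^ 2 * (inner ℂ (interaction γ lam μ f) f).re
      = γ * ‖coords f 0‖ ^ 2 + 2 * lam * ‖coords f 1‖ ^ 2
        + 2 * μ * (‖coords f 2‖ ^ 2 + ‖coords f 3‖ ^ 2) := by
  have hp : ∀ a : C(Torus2, ℂ), inner ℂ (proj a f) f = ((‖inner ℂ (toL2 a) f‖ ^ 2 : ℝ) : ℂ) := by
    intro a
    rw [proj_apply, inner_smul_left, mul_comm, Complex.mul_conj, Complex.normSq_eq_norm_sq]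
  have hpi := Real.pi_pos
  simp only [interaction, _root_.add_apply, _root_.smul_apply, inner_add_left, inner_smul_left,
    hp, Complex.conj_ofReal, fSinSin_inner f hf, fCos_inner f hf, fCosTwo_inner f hf,
    coords_zero, coords_one, coords_two, coords_three, norm_zero]
  simp only [← Complex.ofReal_mul, ← Complex.ofReal_add, Complex.ofReal_re]
  field_simp
  ring

/-- The energy form of the Hamiltonian at a function with values `v`, up to the energy of the
remainder. -/
def reducedFormC (γ lam μ : ℝ) (v : Fin 4 → ℂ) : ℝ :=
  reducedForm γ lam μ (fun i => (v i).re) + reducedForm γ lam μ (fun i => (v i).im)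

theorem reducedFormC_eq (γ lam μ : ℝ) (v : Fin 4 → ℂ) :
    reducedFormC γ lam μ v = (traceSesq v v).re + (γ * ‖v 0‖ ^ 2 + 2 * lam * ‖v 1‖ ^ 2
        + 2 * μ * (‖v 2‖ ^ 2 + ‖v 3‖ ^ 2)) := by
  rw [reducedFormC, reducedForm, reducedForm, traceSesq_self]
  simp only [← Complex.normSq_eq_norm_sq, Complex.normSq_apply]
  ring

theorem reducedFormC_le (γ lam μ : ℝ) (f : L2ees) : reducedFormC γ lam μ (coords f) ≤
    4 * Real.pi ^ 2 * (inner ℂ ((dispEES + interactionEES γ lam μ) f) f).re := by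
  have h1 := traceForm_le_energy f.2
  have h2 := inner_interaction γ lam μ f.2
  have h3 : inner ℂ ((dispEES + interactionEES γ lam μ) f) f
      = inner ℂ (mulOp fDisp (f : L2)) (f : L2) + inner ℂ (interaction γ lam μ f) (f : L2) :=
    inner_add_left _ _ _
  rw [reducedFormC_eq, h3, Complex.add_re, mul_add (4 * Real.pi ^ 2), h2]
  linarith

/-- The trial function with values `v`, built from `harm v` and an approximate constant `h`. -/
def trial (h : L2ees) : (Fin 4 → ℂ) →ₗ[ℂ] L2ees :=
  harm.codRestrict L2ees harm_mem + offset.smulRight h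

theorem coe_trial (h : L2ees) (v : Fin 4 → ℂ) :
    (trial h v : L2) = harm v + offset v • (h : L2) := rfl

theorem inner_trial (γ lam μ : ℝ) (h : L2ees) (hh : ∀ i, coords h i = 1) (v : Fin 4 → ℂ) :
    4 * Real.pi ^ 2 * (inner ℂ ((dispEES + interactionEES γ lam μ) (trial h v)) (trial h v)).re
      = reducedFormC γ lam μ v
        + ‖offset v‖ ^ 2 * (4 * Real.pi ^ 2 * (inner ℂ (mulOp fDisp (h : L2)) (h : L2)).re) := by
  have hc : coords (trial h v) = v := by
    ext i
    rw [coe_trial, map_add, map_smul, Pi.add_apply, Pi.smul_apply, coords_harm, hh, smul_eq_mul]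
    ring
  have h1 := energy_eq (trial h v).2
  have h2 := inner_interaction γ lam μ (trial h v).2
  rw [hc] at h1 h2
  have h3 : inner ℂ ((dispEES + interactionEES γ lam μ) (trial h v)) (trial h v)
      = inner ℂ (mulOp fDisp (trial h v : L2)) (trial h v : L2)
        + inner ℂ (interaction γ lam μ (trial h v)) (trial h v : L2) :=
    inner_add_left _ _ _
  have h4 : (trial h v : L2) - harm v = offset v • (h : L2) := by rw [coe_trial]; abel
  have h5 : inner ℂ (mulOp fDisp (offset v • (h : L2))) (offset v • (h : L2))
      = ((‖offset v‖ ^ 2 : ℝ) : ℂ) * inner ℂ (mulOp fDisp (h : L2)) (h : L2) := by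
    rw [map_smul, inner_smul_left, inner_smul_right, ← mul_assoc,
      mul_comm (starRingEnd ℂ (offset v)), Complex.mul_conj, Complex.normSq_eq_norm_sq]
  rw [h4, h5, Complex.re_ofReal_mul] at h1
  rw [h3, Complex.add_re, mul_add (4 * Real.pi ^ 2), h1, h2, reducedFormC_eq]
  ring

/-- The number of eigenvalues below the essential spectrum is the negative index of the reduced
form. -/
theorem numBelow_of_hasNegIndex {γ lam μ : ℝ} {n : ℕ} (h : HasNegIndex γ lam μ n) :
    numBelow (hamiltonianEES γ lam μ) = n := by
  obtain ⟨X, d, hX, hd, rfl⟩ := h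
  have hpi := Real.pi_pos
  -- The coordinate change, extended to complex vectors.
  let Y : (Fin 4 → ℂ) →ₗ[ℂ] (Fin 4 → ℂ) := Matrix.toLin' (X.map Complex.ofReal)
  have hre : ∀ v i, (Y v i).re = X.mulVec (fun j => (v j).re) i := fun v i => by
    simp [Y, Matrix.mulVec, dotProduct]
  have him : ∀ v i, (Y v i).im = X.mulVec (fun j => (v j).im) i := fun v i => by
    simp [Y, Matrix.mulVec, dotProduct]
  have hY : Function.Injective Y := by
    rw [injective_iff_map_eq_zero]
    intro v hv
    have h1 := hX (fun j => (v j).re) (funext fun i => by rw [← hre, hv]; rfl)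
    have h2 := hX (fun j => (v j).im) (funext fun i => by rw [← him, hv]; rfl)
    exact funext fun i => Complex.ext (congrFun h1 i) (congrFun h2 i)
  have hform : ∀ v, reducedFormC γ lam μ v = ∑ i, d i * ‖Y v i‖ ^ 2 := fun v => by
    rw [reducedFormC, hd, hd, ← Finset.sum_add_distrib]
    refine Finset.sum_congr rfl fun i _ => ?_
    rw [← Complex.normSq_eq_norm_sq, Complex.normSq_apply, hre, him]
    ring
  let e : (Fin 4 → ℂ) ≃ₗ[ℂ] (Fin 4 → ℂ) := LinearEquiv.ofInjectiveEndo Y hY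
  have he : ∀ x, Y (e.symm x) = x := fun x => e.apply_symm_apply x
  let ι := {i // d i < 0}
  let ext0 : (ι → ℂ) →ₗ[ℂ] (Fin 4 → ℂ) := LinearMap.pi fun i =>
    if h : d i < 0 then LinearMap.proj ⟨i, h⟩ else 0
  have hext_neg : ∀ c (i : ι), ext0 c i = c i := fun c i => by
    simp [ext0, i.2]
  have hext_pos : ∀ c i, ¬ d i < 0 → ext0 c i = 0 := fun c i hi => by
    simp [ext0, hi]
  obtain ⟨M, hM, hbound⟩ := exists_bound (offset ∘ₗ e.symm.toLinearMap ∘ₗ ext0)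
  obtain ⟨m, hm, hdm⟩ : ∃ m : ℝ, 0 < m ∧ ∀ i : ι, d i ≤ -m := by
    by_cases hne : Nonempty ι
    · obtain ⟨i0, hi0⟩ := Finite.exists_max fun i : ι => d i
      exact ⟨-d i0, by linarith [i0.2], fun i => by linarith [hi0 i]⟩
    · exact ⟨1, one_pos, fun i => absurd ⟨i⟩ hne⟩
  obtain ⟨h, hh, hh1, hhη⟩ := exists_approx_const (η := m / (2 * M)) (by positivity)
  rw [hamiltonianEES_eq]
  refine numBelow_eq_card dispEES_isPositive (hasFiniteRange_interactionEES γ lam μ)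
    (hamiltonianEES_isSelfAdjoint γ lam μ) dispEES_injective ?_
    (trial ⟨h, hh⟩ ∘ₗ e.symm.toLinearMap ∘ₗ ext0) ?_
    (LinearMap.funLeft ℂ ℂ (Subtype.val : ι → Fin 4) ∘ₗ Y ∘ₗ coords ∘ₗ L2ees.subtype) ?_
  · intro C
    obtain ⟨f, hf, hlt⟩ := exists_mulOp_lt C
    exact ⟨⟨f, hf⟩, hlt⟩
  · intro c hc
    have h1 := inner_trial γ lam μ ⟨h, hh⟩ hh1 (e.symm (ext0 c))
    rw [hform, he] at h1
    have hcn : 0 < ‖c‖ ^ 2 := by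
      have := norm_pos_iff.mpr hc
      positivity
    have h2 : ∑ i, d i * ‖ext0 c i‖ ^ 2 ≤ -m * ‖c‖ ^ 2 := by
      have hne : Nonempty ι := by
        by_contra hempty
        rw [not_nonempty_iff] at hempty
        exact hc (Subsingleton.elim _ _)
      obtain ⟨i0, hi0⟩ := Finite.exists_max fun i : ι => ‖c i‖
      have hcle : ‖c‖ ≤ ‖c i0‖ := (pi_norm_le_iff_of_nonneg (norm_nonneg _)).mpr hi0
      have hterm : ∀ i, d i * ‖ext0 c i‖ ^ 2 ≤ 0 := fun i => by
        by_cases hi : d i < 0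
        · exact mul_nonpos_of_nonpos_of_nonneg hi.le (by positivity)
        · rw [hext_pos c i hi, norm_zero]; simp
      calc ∑ i, d i * ‖ext0 c i‖ ^ 2 ≤ d i0 * ‖ext0 c i0‖ ^ 2 := by
            rw [← Finset.add_sum_erase _ _ (Finset.mem_univ (i0 : Fin 4))]
            have := Finset.sum_nonpos (s := Finset.univ.erase (i0 : Fin 4)) fun i _ => hterm i
            linarith
        _ ≤ -m * ‖c i0‖ ^ 2 := by
            rw [hext_neg]
            exact mul_le_mul_of_nonneg_right (hdm i0) (by positivity)
        _ ≤ -m * ‖c‖ ^ 2 := by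
            have := pow_le_pow_left₀ (norm_nonneg _) hcle 2
            nlinarith
    have h3 : ‖offset (e.symm (ext0 c))‖ ^ 2 * (4 * Real.pi ^ 2 * (inner ℂ (mulOp fDisp h) h).re)
        ≤ m / 2 * ‖c‖ ^ 2 := by
      have h4 := mul_le_mul (hbound c) hhη
        (by have := energy_nonneg h; positivity) (by positivity)
      refine h4.trans (le_of_eq ?_)
      field_simp
    have h5 : 4 * Real.pi ^ 2 * (inner ℂ ((dispEES + interactionEES γ lam μ)
        (trial ⟨h, hh⟩ (e.symm (ext0 c)))) (trial ⟨h, hh⟩ (e.symm (ext0 c)))).re < 0 := by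
      rw [h1]
      have := mul_pos hm hcn
      linarith
    exact (pos_iff_neg_of_mul_neg h5).mp (by positivity)
  · intro f hf
    have h1 := reducedFormC_le γ lam μ f
    rw [hform] at h1
    have h2 : 0 ≤ ∑ i, d i * ‖Y (coords f) i‖ ^ 2 := by
      refine Finset.sum_nonneg fun i _ => ?_
      by_cases hi : d i < 0
      · have : Y (coords f) i = 0 := congrFun hf ⟨i, hi⟩
        rw [this, norm_zero]; simp
      · exact mul_nonneg (not_lt.mp hi) (by positivity)
    exact nonneg_of_mul_nonneg_right (h2.trans h1) (by positivity)

/-! ### Reflection of the energy axis -/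

section Reflection

variable {E : Type} [NormedAddCommGroup E] [NormedSpace ℂ E]

theorem isFredholm_reflect {A B : E →L[ℂ] E} (U : E ≃L[ℂ] E) {c : ℝ}
    (h : ∀ f, U (A f) = (c : ℂ) • U f - B (U f)) {w : ℂ}
    (hA : (A - w • ContinuousLinearMap.id ℂ E).IsFredholm) :
    (B - (c - w) • ContinuousLinearMap.id ℂ E).IsFredholm := by
  obtain ⟨v, hv⟩ := hA.exists_isQuasiInverse
  have hU := U.symm.toLinearEquiv.isQuasiInverse
  have hN := (U.toLinearEquiv.trans (LinearEquiv.neg ℂ)).isQuasiInverse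
  refine .of_isQuasiInverse
    (v := (U : E →L[ℂ] E) ∘L v ∘L (U.symm : E →L[ℂ] E) ∘L (-ContinuousLinearMap.id ℂ E)) ?_
  have hB : ((B - ((c : ℂ) - w) • ContinuousLinearMap.id ℂ E : E →L[ℂ] E) : E →ₗ[ℂ] E)
      = (U.toLinearEquiv.trans (LinearEquiv.neg ℂ)).toLinearMap ∘ₗ
        (A - w • ContinuousLinearMap.id ℂ E).toLinearMap ∘ₗ
          U.symm.toLinearEquiv.toLinearMap := by
    refine LinearMap.ext fun f => ?_
    have h1 := h (U.symm f)
    rw [U.apply_symm_apply] at h1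
    simp [h1, sub_smul]
    abel
  rw [hB]
  exact (hU.comp hv).comp hN

theorem sum_cardinal_comp_equiv {α β : Type} (e : α ≃ β) (f : β → Cardinal.{0}) :
    (Cardinal.sum fun a => f (e a)) = Cardinal.sum f :=
  Cardinal.mk_congr (Equiv.sigmaCongrLeft (β := fun b => (f b).out) e)

theorem essSpectrum_reflect {A B : E →L[ℂ] E} (U : E ≃L[ℂ] E) {c : ℝ}
    (h : ∀ f, U (A f) = (c : ℂ) • U f - B (U f)) (w : ℂ) :
    c - w ∈ essSpectrum B ↔ w ∈ essSpectrum A := by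
  refine not_congr ⟨fun hB => ?_, fun hA => isFredholm_reflect U h hA⟩
  have h' : ∀ g, U.symm (B g) = (c : ℂ) • U.symm g - A (U.symm g) := fun g => by
    have h1 := h (U.symm g)
    rw [U.apply_symm_apply] at h1
    apply U.injective
    rw [map_sub, map_smul, h1, U.apply_symm_apply, U.apply_symm_apply, sub_sub_cancel]
  simpa using isFredholm_reflect U.symm h' hB

/-- If `A` is similar to `c - B`, the eigenvalues above the essential spectrum of `A` correspond
to those below the essential spectrum of `B`. -/
theorem numAbove_eq_numBelow {A B : E →L[ℂ] E} (U : E ≃L[ℂ] E) {c : ℝ}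
    (h : ∀ f, U (A f) = (c : ℂ) • U f - B (U f)) : numAbove A = numBelow B := by
  have hess := essSpectrum_reflect U h
  let e : {z : ℝ | ∀ w ∈ essSpectrum A, w.re < z} ≃ {z : ℝ | ∀ w ∈ essSpectrum B, z < w.re} :=
    (Equiv.subLeft c).subtypeEquiv fun z => by
      constructor
      · intro hz w hw
        have := hz (c - w) (by rw [← hess]; simpa using hw)
        simp at this ⊢
        linarith
      · intro hz w hw
        have := hz (c - w) ((hess w).mpr hw)
        simp at this
        linarith
  have hmem : ∀ z : ℝ,
      (Module.End.eigenspace (A : Module.End ℂ E) (z : ℂ)).map U.toLinearEquiv.toLinearMap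
        = Module.End.eigenspace (B : Module.End ℂ E) ((c - z : ℝ) : ℂ) := fun z => by
    ext g
    rw [Submodule.mem_map_equiv, Module.End.mem_eigenspace_iff, Module.End.mem_eigenspace_iff]
    change A (U.symm g) = (z : ℂ) • U.symm g ↔ B g = ((c - z : ℝ) : ℂ) • g
    have h1 := h (U.symm g)
    rw [U.apply_symm_apply] at h1
    rw [← U.injective.eq_iff, h1, map_smul, U.apply_symm_apply, Complex.ofReal_sub, sub_smul,
      sub_eq_iff_eq_add, eq_comm (a := B g), sub_eq_iff_eq_add, add_comm (B g)]
  rw [numAbove, numBelow, eigenvalueCount, eigenvalueCount]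
  have hrank : ∀ z : {z : ℝ | ∀ w ∈ essSpectrum A, w.re < z},
      Module.rank ℂ (Module.End.eigenspace (A : Module.End ℂ E) ((z : ℝ) : ℂ))
        = Module.rank ℂ (Module.End.eigenspace (B : Module.End ℂ E) ((e z : ℝ) : ℂ)) := fun z => by
    have he : (e z : ℝ) = c - z := rfl
    rw [he, ← hmem]
    exact (U.toLinearEquiv.submoduleMap _).rank_eq
  simp_rw [hrank]
  rw [sum_cardinal_comp_equiv e fun z =>
    Module.rank ℂ (Module.End.eigenspace (B : Module.End ℂ E) ((z : ℝ) : ℂ))]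

end Reflection

/-- The half-period `(π, π)`. -/
def halfPeriod : Torus2 := ((Real.pi : Circ), (Real.pi : Circ))

theorem halfPeriod_add_self : halfPeriod + halfPeriod = 0 := by
  have h : (Real.pi : Circ) + (Real.pi : Circ) = 0 := by
    rw [← AddCircle.coe_add, ← two_mul, AddCircle.coe_period]
  exact Prod.ext h h

theorem neg_halfPeriod : -halfPeriod = halfPeriod :=
  neg_eq_of_add_eq_zero_left halfPeriod_add_self

theorem mp_shift : MeasurePreserving (fun p : Torus2 => p + halfPeriod) volume volume :=
  (measurePreserving_add_right (volume : Measure Circ) _).prod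
    (measurePreserving_add_right (volume : Measure Circ) _)

theorem cosC_add_pi (x : Circ) : cosC (x + (Real.pi : Circ)) = -cosC x := by
  induction x using QuotientAddGroup.induction_on with
  | H z => exact Real.cos_add_pi z

theorem sinC_add_pi (x : Circ) : sinC (x + (Real.pi : Circ)) = -sinC x := by
  induction x using QuotientAddGroup.induction_on with
  | H z => exact Real.sin_add_pi z

theorem two_nsmul_add_pi (x : Circ) : (2 : ℕ) • (x + (Real.pi : Circ)) = (2 : ℕ) • x := by
  have h : (Real.pi : Circ) + (Real.pi : Circ) = 0 := congrArg Prod.fst halfPeriod_add_self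
  rw [nsmul_add, two_nsmul (Real.pi : Circ), h, add_zero]

/-- Translation by `(π, π)` on `L²`. -/
def shift : L2 →ₗᵢ[ℂ] L2 := Lp.compMeasurePreservingₗᵢ ℂ _ mp_shift

theorem coeFn_shift (f : L2) :
    ∀ᵐ p ∂(volume : Measure Torus2), shift f p = f (p + halfPeriod) :=
  Lp.coeFn_compMeasurePreserving f mp_shift

theorem shift_shift (f : L2) : shift (shift f) = f := by
  refine Lp.ext ?_
  filter_upwards [coeFn_shift (shift f), mp_shift.quasiMeasurePreserving.ae (coeFn_shift f)]
    with p h1 h2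
  rw [h1, h2, add_assoc, halfPeriod_add_self, add_zero]

theorem shift_mem_invariantL2 (σ : Torus2 → Torus2) (hσ : MeasurePreserving σ volume volume)
    (hc : ∀ p, σ (p + halfPeriod) = σ p + halfPeriod) {f : L2} (hf : f ∈ invariantL2 σ hσ) :
    shift f ∈ invariantL2 σ hσ := by
  have hf' : ∀ᵐ p ∂(volume : Measure Torus2), f (σ p) = f p := hf
  change ∀ᵐ p ∂(volume : Measure Torus2), shift f (σ p) = shift f p
  filter_upwards [coeFn_shift f, hσ.quasiMeasurePreserving.ae (coeFn_shift f),
    mp_shift.quasiMeasurePreserving.ae hf'] with p h1 h2 h3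
  rw [h1, h2, ← hc, h3]

theorem shift_mem {f : L2} (hf : f ∈ L2ees) : shift f ∈ L2ees := by
  refine ⟨⟨shift_mem_invariantL2 _ _ (fun p => ?_) hf.1.1,
    shift_mem_invariantL2 _ _ (fun p => rfl) hf.1.2⟩,
    shift_mem_invariantL2 _ _ (fun p => ?_) hf.2⟩
  · rw [neg_add, neg_halfPeriod]
  · have h : -(Real.pi : Circ) = (Real.pi : Circ) := congrArg Prod.fst neg_halfPeriod
    refine Prod.ext ?_ rfl
    change -(p.1 + (Real.pi : Circ)) = -p.1 + (Real.pi : Circ)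
    rw [neg_add, h]

theorem shift_toL2 (a b : C(Torus2, ℂ)) (hab : ∀ p, a (p + halfPeriod) = b p) :
    shift (toL2 a) = toL2 b := by
  refine Lp.ext ?_
  filter_upwards [coeFn_shift (toL2 a), mp_shift.quasiMeasurePreserving.ae (coeFn_toL2 a),
    coeFn_toL2 b] with p h1 h2 h3
  rw [h1, h2, h3, hab]

theorem shift_proj (a : C(Torus2, ℂ)) (ha : ∀ p, a (p + halfPeriod) = a p) (f : L2) :
    shift (proj a f) = proj a (shift f) := by
  rw [proj_apply, proj_apply, map_smul, shift_toL2 a a ha, ← LinearIsometry.inner_map_map shift,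
    shift_toL2 a a ha]

theorem shift_proj_of_neg (a : C(Torus2, ℂ)) (ha : ∀ p, a (p + halfPeriod) = -a p) (f : L2) :
    shift (proj a f) = proj a (shift f) := by
  have h : shift (toL2 a) = -toL2 a := by
    rw [shift_toL2 a (-a) ha]
    exact map_neg (ContinuousMap.toLp 2 volume ℂ) _
  rw [proj_apply, proj_apply, map_smul, ← LinearIsometry.inner_map_map shift, h,
    inner_neg_left, smul_neg, neg_smul, neg_neg]

theorem shift_interaction (γ lam μ : ℝ) (f : L2) :
    shift (interaction γ lam μ f) = interaction γ lam μ (shift f) := by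
  simp only [interaction, _root_.add_apply, _root_.smul_apply, map_add, map_smul]
  rw [shift_proj fOne fun _ => rfl,
    shift_proj_of_neg fCos1 fun p => ?_, shift_proj_of_neg fCos2 fun p => ?_,
    shift_proj fCosTwo1 fun p => ?_, shift_proj fCosTwo2 fun p => ?_,
    shift_proj fCosCos fun p => ?_, shift_proj fSinSin fun p => ?_]
  all_goals simp [fCos1, fCos2, fCosTwo1, fCosTwo2, fCosCos, fSinSin, halfPeriod, cosC_add_pi,
    sinC_add_pi, two_nsmul_add_pi, -nsmul_eq_mul, -smul_add]

theorem interaction_neg (γ lam μ : ℝ) : interaction (-γ) (-lam) (-μ) = -interaction γ lam μ := by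
  simp only [interaction, neg_div, Complex.ofReal_neg, neg_smul]
  abel

theorem shift_mulOp_fDisp (f : L2) :
    shift (mulOp fDisp f) = (8 : ℂ) • shift f - mulOp fDisp (shift f) := by
  have h0 : ∀ p, fDisp (p + halfPeriod) = 8 - fDisp p := fun p => by
    simp [fDisp, halfPeriod, cosC_add_pi]
    ring
  refine Lp.ext ?_
  filter_upwards [coeFn_shift (mulOp fDisp f), coeFn_shift f,
    mp_shift.quasiMeasurePreserving.ae (coeFn_mulOp fDisp f), coeFn_mulOp fDisp (shift f),
    Lp.coeFn_sub ((8 : ℂ) • shift f) (mulOp fDisp (shift f)), Lp.coeFn_smul (8 : ℂ) (shift f)]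
    with p h1 h2 h3 h4 h5 h6
  rw [h1, h3, h5, Pi.sub_apply, h6, h4, Pi.smul_apply, h2, h0, smul_eq_mul, sub_mul]

/-- Translation by `(π, π)` turns the Hamiltonian into `8` minus the Hamiltonian with the opposite
couplings. -/
theorem shift_hamiltonian (γ lam μ : ℝ) (f : L2) : shift (hamiltonian γ lam μ f)
    = (8 : ℂ) • shift f - hamiltonian (-γ) (-lam) (-μ) (shift f) := by
  rw [hamiltonian, hamiltonian, _root_.add_apply, _root_.add_apply, map_add, shift_mulOp_fDisp,
    shift_interaction, interaction_neg, _root_.neg_apply]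
  abel

/-- Translation by `(π, π)` on `L^{2,ees}`. -/
def shiftEES : L2ees ≃L[ℂ] L2ees :=
  ContinuousLinearEquiv.equivOfInverse
    (shift.toContinuousLinearMap.restrict fun _ => shift_mem)
    (shift.toContinuousLinearMap.restrict fun _ => shift_mem)
    (fun f => Subtype.ext (shift_shift f)) (fun f => Subtype.ext (shift_shift f))

theorem numAbove_hamiltonianEES (γ lam μ : ℝ) : numAbove (hamiltonianEES γ lam μ)
    = numBelow (hamiltonianEES (-γ) (-lam) (-μ)) :=
  numAbove_eq_numBelow (c := 8) shiftEES fun f =>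
    Subtype.ext (by simpa using! shift_hamiltonian γ lam μ f)

theorem Q0_reflect (μ : ℝ) : Q0 1 μ = Q0 (-1) (-μ) := by
  rw [Q0, Q0]; ring

theorem Q1_reflect (μ : ℝ) : Q1 1 μ = Q1 (-1) (-μ) := by
  rw [Q1, Q1]; ring

theorem lamCurve_reflect (μ : ℝ) : lamCurve 1 μ = -lamCurve (-1) (-μ) := by
  rw [lamCurve, lamCurve, Q0_reflect, Q1_reflect]; ring

theorem gamSurf_reflect (lam μ : ℝ) : gamSurf 1 lam μ = -gamSurf (-1) (-lam) (-μ) := by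
  rw [gamSurf, gamSurf, Q0_reflect, Q1_reflect,
    show -lam * Q0 (-1) (-μ) - -1 * Q1 (-1) (-μ) = -(lam * Q0 (-1) (-μ) - 1 * Q1 (-1) (-μ)) by ring,
    div_neg]
  ring

theorem component_reflect {ζ : Fin 5} {γ lam μ : ℝ} (h : (γ, lam, μ) ∈ component 1 ζ) :
    (-γ, -lam, -μ) ∈ component (-1) ζ := by
  fin_cases ζ <;>
  simp only [component, before3, beyond3, cyl, tau, D1, D2, D3, D4, before, beyond, I1, I2, I3,
    Set.mem_union, Set.mem_ofPred_eq, gamSurf_reflect, lamCurve_reflect] at h ⊢ <;>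
  simp only [one_mul, neg_one_mul, neg_neg, neg_eq_iff_eq_neg] at h ⊢ <;>
  exact h

end TwoBoson

end

theorem mainTheorem4 (ζ : Fin 5) :
    (∃ n : ℕ, ∀ γ lam μ : ℝ, (γ, lam, μ) ∈ TwoBoson.component 1 ζ →
      TwoBoson.numAbove (TwoBoson.hamiltonianEES γ lam μ) = n) ∧
    (∃ n : ℕ, ∀ γ lam μ : ℝ, (γ, lam, μ) ∈ TwoBoson.component (-1) ζ →
      TwoBoson.numBelow (TwoBoson.hamiltonianEES γ lam μ) = n) := by
  refine ⟨⟨ζ, fun γ lam μ h => ?_⟩, ⟨ζ, fun γ lam μ h => ?_⟩⟩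
  · rw [TwoBoson.numAbove_hamiltonianEES]
    exact TwoBoson.numBelow_of_hasNegIndex
      (TwoBoson.hasNegIndex_of_mem_component ζ (TwoBoson.component_reflect h))
  · exact TwoBoson.numBelow_of_hasNegIndex (TwoBoson.hasNegIndex_of_mem_component ζ h)
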